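/- Let $D\ge 1$. For a compact set $K\subset\mathbb{R}^D$ (a mesh cell) of positive volume whose boundary has finite positive surface area, and $k\ge 0$, let $\mathbb{P}^k_D$ be the space of real polynomials in $D$ variables of total degree at most $k$. For a polynomial $U$ let $\overline{\mathcal{C}}_K U$ be the average of $U$ over $K$ with respect to Lebesgue measure, and let $\overline{\mathcal{B}}_K U$ be the average of $U$ over the boundary $\partial K$ with respect to surface area, i.e. $(D-1)$-dimensional Hausdorff measure (counting measure if $D=1$). Define the optimal interior weight $$\overline{M}^k_K := \sup\left\{\frac{\overline{\mathcal{B}}_K U}{\overline{\mathcal{C}}_K U} \;:\; U\in\mathbb{P}^k_D,\ U\ge 0 \text{ on } K,\ \overline{\mathcal{C}}_K U>0\right\}.$$ Let $\bigcirc^D=\{x\in\mathbb{R}^D:|x|\le 1\}$ be the closed Euclidean unit ball and $[0,1]^D$ the unit box. Then for every integer $n\ge 0$, $$\overline{M}^{2n}_{\bigcirc^D}=\overline{M}^{2n+1}_{\bigcirc^D}=\frac{\left(\lfloor n/2\rfloor+1\right)\left(2\lfloor (n+1)/2\rfloor+D\right)}{D}.$$ Furthermore, for every integer $k\ge 0$,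 $\overline{M}^k_{[0,1]^D}\le\overline{M}^k_{\bigcirc^D}$, with equality if and only if $D=1$ or $k<4$. -/

import Mathlib

open MeasureTheory Measure

noncomputable section

/-- The value of a polynomial in `D` variables at a point of Euclidean space. -/
def polyEval {D : ℕ} (U : MvPolynomial (Fin D) ℝ) (x : EuclideanSpace ℝ (Fin D)) : ℝ :=
  MvPolynomial.eval (fun i => x i) U

/-- The cell average of `U`, with respect to Lebesgue measure on the mesh cell `K`. -/
def cellAverage {D : ℕ} (K : Set (EuclideanSpace ℝ (Fin D))) (U : MvPolynomial (Fin D) ℝ) : ℝ :=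
  ⨍ x in K, polyEval U x

/-- The boundary average of `U`, with respect to surface area, that is `(D - 1)`-dimensional
Hausdorff measure, on the boundary of the mesh cell `K` (counting measure if `D = 1`). -/
def boundaryAverage {D : ℕ} (K : Set (EuclideanSpace ℝ (Fin D)))
    (U : MvPolynomial (Fin D) ℝ) : ℝ :=
  ⨍ x in frontier K, polyEval U x ∂μH[(D : ℝ) - 1]

/-- The boundary crowding of `U`: the ratio of its boundary average to its cell average. -/
def boundaryCrowding {D : ℕ} (K : Set (EuclideanSpace ℝ (Fin D)))
    (U : MvPolynomial (Fin D) ℝ) : ℝ :=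
  boundaryAverage K U / cellAverage K U

/-- The positive solutions: the elements of the representation space `V` that are nonnegative
on the mesh cell `K` and have strictly positive cell average. -/
def positiveSolutions {D : ℕ} (K : Set (EuclideanSpace ℝ (Fin D)))
    (V : Submodule ℝ (MvPolynomial (Fin D) ℝ)) : Set (MvPolynomial (Fin D) ℝ) :=
  {U | U ∈ V ∧ (∀ x ∈ K, 0 ≤ polyEval U x) ∧ 0 < cellAverage K U}

/-- The optimal interior weight: the supremum of the boundary crowding over all positive
solutions, taken in the extended reals (so that it is `⊤` when there is no finite bound). -/
def optimalWeight {D : ℕ} (K : Set (EuclideanSpace ℝ (Fin D)))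
    (V : Submodule ℝ (MvPolynomial (Fin D) ℝ)) : EReal :=
  ⨆ U ∈ positiveSolutions K V, (boundaryCrowding K U : EReal)

/-- The space of polynomials in `D` variables of total degree at most `k`. -/
abbrev polySpace (D k : ℕ) : Submodule ℝ (MvPolynomial (Fin D) ℝ) :=
  MvPolynomial.restrictTotalDegree (Fin D) ℝ k

/-- The spherical mesh cell: the closed unit ball. -/
def ballCell (D : ℕ) : Set (EuclideanSpace ℝ (Fin D)) :=
  Metric.closedBall 0 1

/-- The box mesh cell `[0,1]^D`. -/
def boxCell (D : ℕ) : Set (EuclideanSpace ℝ (Fin D)) :=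
  {x | ∀ i, x i ∈ Set.Icc (0 : ℝ) 1}

end

/-! The problem reduces to one variable by averaging over concentric copies of the boundary. Put `D
= d + 1`, centre the cell at the origin, and write `B` and `C` for the boundary and cell averages.
For the ball and for `[-1, 1] ^ D` every supporting hyperplane of the boundary has distance 1 from
the origin, so the divergence theorem for the field `x U` relates `B` and `C` on each homogeneous
component (`RadialPair`). By central symmetry odd components average to zero. Hence `B (U (r •))` is
`p (r ^ 2)` with `deg p ≤ ⌊k / 2⌋`, `B U = p 1`, and `C U = D ∫₀¹ r ^ (D - 1) p (r ^ 2) dr`;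
moreover `p ≥ 0` on `[0, 1]` when `U ≥ 0` on the cell.

It remains to bound `p 1` by a weighted integral of `p ≥ 0` with `deg p ≤ n`. The Gauss–Radau rule
(`n` even) or Gauss–Lobatto rule (`n` odd) is exact on such `p` and has positive weights, so the
bound is the reciprocal of its weight at 1. That weight follows from the Jacobi differential
equation at 1 (`eval_one_sq`). Equality holds exactly when `p` vanishes at the other nodes
(`exists_endpoint_bound`). On the ball the extremal `p` is realised by `p (‖x‖ ^ 2)`, so the bound
is sharp. The same argument gives the same upper bound for the box.

On the box the bound is sharp if `D = 1` (again `p (‖x‖ ^ 2)`) or if `k < 4` (the polynomials 1 and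
`x₀ ^ 2`). Otherwise there is an interior node, and an extremal `V ≥ 0` would vanish on the surfaces
of the corresponding concentric cubes, hence on the full hyperplanes carrying their faces. Suitable
lines meet these sets in more double roots than the degree allows, so `V = 0`
(`eq_zero_of_vanish_on_cubes`). As the supremum over a finite-dimensional cone is attained
(`exists_max_ratio`), the inequality is strict. -/

noncomputable section

/-! ### Radial moments and orthogonal polynomials on `[0, 1]` -/

open Polynomial in
/-- The moment functional `p ↦ ∫₀¹ 2 r ^ d p (r²) dr`, that is integration on `[0, 1]` against the
weight `t ^ ((d - 1) / 2)`. -/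
def radialMoment (d : ℕ) : ℝ[X] →ₗ[ℝ] ℝ where
  toFun p := ∫ r in (0 : ℝ)..1, 2 * r ^ d * p.eval (r ^ 2)
  map_add' p q := by
    rw [← intervalIntegral.integral_add]
    · simp only [eval_add, mul_add]
    · exact Continuous.intervalIntegrable (by fun_prop) _ _
    · exact Continuous.intervalIntegrable (by fun_prop) _ _
  map_smul' c p := by
    rw [RingHom.id_apply, smul_eq_mul, ← intervalIntegral.integral_const_mul]
    congr 1 with r
    simp only [eval_smul, smul_eq_mul]
    ring

namespace Radau
open Polynomial Set

lemma moment_def (d : ℕ) (p : ℝ[X]) :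
    radialMoment d p = ∫ r in (0 : ℝ)..1, 2 * r ^ d * p.eval (r ^ 2) := rfl

lemma moment_X_pow (d j : ℕ) : radialMoment d (X ^ j) = 1 / (j + (d + 1) / 2) := by
  have : ∀ r : ℝ, 2 * r ^ d * (X ^ j : ℝ[X]).eval (r ^ 2) = 2 * r ^ (d + 2 * j) := by
    intro r; simp; ring
  simp only [moment_def, this, intervalIntegral.integral_const_mul, integral_pow]
  have : (0 : ℝ) < j + (d + 1) / 2 := by positivity
  push_cast
  field_simp
  simp
  ring

lemma moment_X_pow_mul (d e : ℕ) (p : ℝ[X]) :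
    radialMoment d (X ^ e * p) = radialMoment (d + 2 * e) p := by
  simp only [moment_def]
  congr 1 with r
  simp
  ring

lemma moment_pos (d : ℕ) {p : ℝ[X]} (h0 : p ≠ 0) (hp : ∀ t ∈ Icc (0 : ℝ) 1, 0 ≤ p.eval t) :
    0 < radialMoment d p := by
  obtain ⟨t, ht, hpt⟩ : ∃ t ∈ Ioo (0 : ℝ) 1, p.eval t ≠ 0 := by
    by_contra! h
    exact h0 (eq_zero_of_infinite_isRoot p ((Ioo_infinite zero_lt_one).mono h))
  have hs : √t ^ 2 = t := Real.sq_sqrt ht.1.le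
  have hs0 : 0 < √t := Real.sqrt_pos.2 ht.1
  have hs1 : √t ≤ 1 := Real.sqrt_le_one.2 ht.2.le
  rw [moment_def]
  refine intervalIntegral.integral_pos zero_lt_one (by fun_prop) (fun r hr => ?_)
    ⟨√t, ⟨hs0.le, hs1⟩, ?_⟩
  · have : 0 ≤ p.eval (r ^ 2) := hp _ ⟨by positivity, pow_le_one₀ hr.1.le hr.2⟩
    have := hr.1
    positivity
  · rw [hs]
    have : 0 < p.eval t := lt_of_le_of_ne (hp t ⟨ht.1.le, ht.2.le⟩) (Ne.symm hpt)
    positivity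

/-- Integration by parts for the moment functional. -/
lemma moment_euler (d : ℕ) (F : ℝ[X]) :
    radialMoment d (C (((d : ℝ) + 1) / 2) * F + X * derivative F) = F.eval 1 := by
  induction F using Polynomial.induction_on' with
  | add p q hp hq =>
    rw [eval_add, ← hp, ← hq, ← map_add, derivative_add]
    congr 1
    ring
  | monomial n a =>
    have : C (((d : ℝ) + 1) / 2) * monomial n a + X * derivative (monomial n a)
        = (a * (n + (d + 1) / 2)) • (X ^ n : ℝ[X]) := by
      rw [smul_eq_C_mul, ← C_mul_X_pow_eq_monomial, derivative_C_mul_X_pow]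
      rcases n with _ | n
      · simp; ring
      · simp only [map_mul, map_add, Nat.add_sub_cancel, map_natCast]
        push_cast
        ring
    rw [this, map_smul, moment_X_pow, smul_eq_mul, eval_monomial, one_pow, mul_one]
    have : (0 : ℝ) < n + (d + 1) / 2 := by positivity
    field_simp

/-- Orthogonality to all polynomials of smaller degree, for the weight `(1 - t) t ^ ((d - 1) / 2)`
on `[0, 1]`. -/
structure IsOrthogonal (d m : ℕ) (φ : ℝ[X]) : Prop where
  ne_zero : φ ≠ 0
  natDegree_le : φ.natDegree ≤ m
  orthogonal : ∀ g : ℝ[X], g.degree < m → radialMoment d ((1 - X) * φ * g) = 0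

lemma exists_isOrthogonal (d m : ℕ) : ∃ φ, IsOrthogonal d m φ := by
  let T : degreeLT ℝ (m + 1) →ₗ[ℝ] (Fin m → ℝ) :=
    LinearMap.pi fun i => (radialMoment d ∘ₗ LinearMap.mulRight ℝ ((1 - X) * X ^ (i : ℕ))) ∘ₗ
      (degreeLT ℝ (m + 1)).subtype
  have hfin : Module.finrank ℝ (degreeLT ℝ (m + 1)) = m + 1 := by
    rw [(degreeLTEquiv ℝ (m + 1)).finrank_eq]; simp
  have : FiniteDimensional ℝ (degreeLT ℝ (m + 1)) :=
    Module.Finite.equiv (degreeLTEquiv ℝ (m + 1)).symm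
  have hker : LinearMap.ker T ≠ ⊥ := LinearMap.ker_ne_bot_of_finrank_lt (by simp [hfin])
  obtain ⟨φ, hφ, hne⟩ := (Submodule.ne_bot_iff _).1 hker
  refine ⟨φ, ?_, ?_, fun g hg => ?_⟩
  · simpa using hne
  · have := mem_degreeLT.1 φ.2
    exact Nat.lt_succ_iff.1 ((natDegree_lt_iff_degree_lt (by simpa using hne)).2 (by exact_mod_cast this))
  · rcases eq_or_ne g 0 with rfl | hg0
    · simp
    rw [as_sum_range' g m ((natDegree_lt_iff_degree_lt hg0).2 hg), Finset.mul_sum, _root_.map_sum]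
    refine Finset.sum_eq_zero fun i hi => ?_
    have := congrFun (LinearMap.mem_ker.1 hφ) ⟨i, Finset.mem_range.1 hi⟩
    simp only [T, LinearMap.pi_apply, LinearMap.comp_apply, LinearMap.mulRight_apply,
      Submodule.subtype_apply, Pi.zero_apply] at this
    rw [← C_mul_X_pow_eq_monomial, show (1 - X) * (φ : ℝ[X]) * (C (g.coeff i) * X ^ i)
      = g.coeff i • ((φ : ℝ[X]) * ((1 - X) * X ^ i)) by rw [smul_eq_C_mul]; ring, map_smul, this,
      smul_zero]

section
variable {d m : ℕ} {φ : ℝ[X]} (h : IsOrthogonal d m φ)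
include h

/-- An orthogonal polynomial has no nontrivial factor of constant sign. -/
lemma IsOrthogonal.not_nonneg {s g : ℝ[X]} (hs : g.degree < m) (hφ : φ = s * g)
    (hpos : ∀ t ∈ Ioo (0 : ℝ) 1, 0 ≤ s.eval t) : False := by
  have hg : g ≠ 0 := by rintro rfl; exact h.ne_zero (by simp [hφ])
  have hs' : s ≠ 0 := by rintro rfl; exact h.ne_zero (by simp [hφ])
  have hcl : ∀ t ∈ Icc (0 : ℝ) 1, 0 ≤ s.eval t := by
    rw [← closure_Ioo zero_ne_one]
    exact fun t ht => (isClosed_Ici.preimage s.continuous).closure_subset_iff.2 hpos ht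
  have h1 : (1 - X : ℝ[X]) ≠ 0 := by
    intro h0; simpa using congrArg (eval 0) h0
  have := h.orthogonal g hs
  rw [hφ] at this
  -- Orthogonality to `g` makes the moment of `(1 - X) s g ^ 2` zero, although this polynomial is
  -- nonzero and nonnegative on `[0, 1]`.
  refine (moment_pos d (p := (1 - X) * (s * g) * g) ?_ ?_).ne' this
  · exact mul_ne_zero (mul_ne_zero h1 (mul_ne_zero hs' hg)) hg
  · intro t ht
    have := mul_nonneg (mul_nonneg (sub_nonneg.2 ht.2) (hcl t ht)) (mul_self_nonneg (g.eval t))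
    simp only [eval_mul, eval_sub, eval_one, eval_X]
    linarith

lemma IsOrthogonal.degree_eq : φ.degree = m := by
  refine le_antisymm (degree_le_of_natDegree_le h.natDegree_le) (not_lt.1 fun hlt => ?_)
  exact h.not_nonneg hlt (one_mul φ).symm (by simp)

lemma IsOrthogonal.natDegree_eq : φ.natDegree = m := natDegree_eq_of_degree_eq_some h.degree_eq

lemma IsOrthogonal.degree_lt {s g : ℝ[X]} (hs : 0 < s.natDegree) (hφ : φ = s * g) :
    g.degree < m := by
  have hg : g ≠ 0 := by rintro rfl; exact h.ne_zero (by simp [hφ])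
  have hs' : s ≠ 0 := by rintro rfl; exact h.ne_zero (by simp [hφ])
  have := natDegree_mul hs' hg
  rw [← hφ, h.natDegree_eq] at this
  rw [← natDegree_lt_iff_degree_lt hg]
  omega

/-- Without a root in `(0, 1)` the factor `s` would have constant sign there by the intermediate
value theorem, and `s` or `-s` would contradict `not_nonneg`. -/
lemma IsOrthogonal.exists_root {s g : ℝ[X]} (hs : 0 < s.natDegree) (hφ : φ = s * g) :
    ∃ t ∈ Ioo (0 : ℝ) 1, s.eval t = 0 := by
  by_contra! hne
  have hlt := h.degree_lt hs hφ
  have half : (1 / 2 : ℝ) ∈ Ioo (0 : ℝ) 1 := by norm_num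
  have hc : IsPreconnected (Ioo (0 : ℝ) 1) := isPreconnected_Ioo
  have key : ∀ q : ℝ[X], (∀ t ∈ Ioo (0 : ℝ) 1, q.eval t ≠ 0) → 0 ≤ q.eval (1 / 2) →
      ∀ t ∈ Ioo (0 : ℝ) 1, 0 ≤ q.eval t := by
    intro q hq h0 t ht
    by_contra! hlt
    obtain ⟨z, hz, hqz⟩ := hc.intermediate_value ht half q.continuous.continuousOn
      (show (0 : ℝ) ∈ Icc _ _ from ⟨hlt.le, h0⟩)
    exact hq z hz hqz
  rcases le_total 0 (s.eval (1 / 2)) with h0 | h0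
  · exact h.not_nonneg hlt hφ (key s hne h0)
  · refine h.not_nonneg (s := -s) (g := -g) (by rwa [degree_neg]) (by rw [hφ]; ring)
      (key (-s) ?_ ?_)
    · simpa using hne
    · simpa using h0

lemma IsOrthogonal.not_sq_dvd (z : ℝ) : ¬ (X - C z) ^ 2 ∣ φ := by
  rintro ⟨g, hg⟩
  refine h.not_nonneg (h.degree_lt ?_ hg) hg fun t _ => ?_
  · simp
  · simp only [eval_pow]; positivity

/-- Split off the roots in `(0, 1)`. A nonconstant cofactor would have a further root in `(0, 1)`,
necessarily a repeated one, and a squared linear factor is a factor of constant sign. -/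
lemma IsOrthogonal.exists_nodes : ∃ S : Finset ℝ, (∀ t ∈ S, t ∈ Ioo (0 : ℝ) 1) ∧ S.card = m ∧
    ∃ c : ℝ, c ≠ 0 ∧ φ = C c * ∏ t ∈ S, (X - C t) := by
  classical
  let S := φ.roots.toFinset.filter (fun t => t ∈ Ioo (0 : ℝ) 1)
  have hS : ∀ t, t ∈ S ↔ φ.eval t = 0 ∧ t ∈ Ioo (0 : ℝ) 1 := by
    intro t; simp [S, h.ne_zero]
  have hdvd : ∏ t ∈ S, (X - C t) ∣ φ := by
    refine Finset.prod_dvd_of_coprime ?_ ?_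
    · exact fun a _ b _ hab => pairwise_coprime_X_sub_C Function.injective_id hab
    · exact fun t ht => dvd_iff_isRoot.2 ((hS t).1 ht).1
  obtain ⟨g, hg⟩ := hdvd
  have hg0 : g.natDegree = 0 := by
    by_contra hpos
    obtain ⟨z, hz, hgz⟩ := h.exists_root (Nat.pos_of_ne_zero hpos) (hg.trans (mul_comm _ _))
    have hzS : z ∈ S := (hS z).2 ⟨by rw [hg, eval_mul, hgz, mul_zero], hz⟩
    refine h.not_sq_dvd z ?_
    rw [hg, pow_two]
    exact mul_dvd_mul (Finset.dvd_prod_of_mem _ hzS) (dvd_iff_isRoot.2 hgz)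
  obtain ⟨c, rfl⟩ := natDegree_eq_zero.1 hg0
  have hc : c ≠ 0 := by rintro rfl; exact h.ne_zero (by simp [hg])
  refine ⟨S, fun t ht => ((hS t).1 ht).2, ?_, c, hc, by rw [hg, mul_comm]⟩
  have := h.natDegree_eq
  rwa [hg, natDegree_mul_C hc, natDegree_prod_of_monic _ _ (fun t _ => monic_X_sub_C t),
    Finset.sum_congr rfl (fun t _ => natDegree_X_sub_C t), Finset.sum_const, smul_eq_mul,
    mul_one] at this

end
end Radau

/-! ### The Jacobi equation, the value at the endpoint, interpolatory quadrature -/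

namespace Radau
open Polynomial Set

/-- The Jacobi differential operator, with `b = (d + 1) / 2`. -/
def jacobiOp (b : ℝ) (f : ℝ[X]) : ℝ[X] :=
  X * derivative (derivative f) - X * (X * derivative (derivative f)) + C b * derivative f
    - C (b + 2) * (X * derivative f)

lemma coeff_jacobiOp (b : ℝ) (f : ℝ[X]) (j : ℕ) :
    (jacobiOp b f).coeff j =
      (j + 1) * (j + b) * f.coeff (j + 1) - j * (j + b + 1) * f.coeff j := by
  rcases j with _ | _ | j
  · simp [jacobiOp, coeff_derivative]
  · simp [jacobiOp, coeff_derivative, coeff_X_mul, -map_add]; ring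
  · simp [jacobiOp, coeff_derivative, coeff_X_mul, -map_add]; ring

lemma degree_jacobiOp_lt {b : ℝ} {g : ℝ[X]} {m : ℕ} (hg : g.degree < m) :
    (jacobiOp b g).degree < m := by
  rw [degree_lt_iff_coeff_zero] at hg ⊢
  intro j hj
  rw [coeff_jacobiOp, hg j hj, hg (j + 1) (by omega)]
  ring

/-- Integration by parts; the factor `(1 - X) ^ 2` kills the boundary term at 1. The right side is
symmetric in `f` and `g`, so the operator is self-adjoint for the weight `(1 - t) t ^ ((d - 1) /
2)`. -/
lemma moment_jacobiOp_mul (d : ℕ) (f g : ℝ[X]) :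
    radialMoment d ((1 - X) * jacobiOp ((d + 1) / 2) f * g) =
      - radialMoment d (X * (1 - X) ^ 2 * derivative f * derivative g) := by
  have := moment_euler d ((1 - X) ^ 2 * derivative f * g)
  rw [eval_mul, eval_mul, eval_pow, eval_sub, eval_one, eval_X, sub_self, zero_pow two_ne_zero,
    zero_mul, zero_mul] at this
  rw [eq_neg_iff_add_eq_zero, ← map_add, ← this]
  congr 1
  simp only [jacobiOp, derivative_mul, derivative_pow, derivative_sub, derivative_one,
    derivative_X, map_add]
  simp
  ring

lemma exists_sub_eval_one {m : ℕ} {p : ℝ[X]} (hp : p.natDegree ≤ m) :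
    ∃ k : ℝ[X], k.degree < m ∧ p = C (p.eval 1) + (1 - X) * k := by
  obtain ⟨k, hk⟩ := X_sub_C_dvd_sub_C_eval (a := (1 : ℝ)) (p := p)
  refine ⟨-k, ?_, by rw [C_1] at hk; linear_combination hk⟩
  rw [degree_neg]
  rcases eq_or_ne k 0 with rfl | hk0
  · simp
  · rw [← natDegree_lt_iff_degree_lt hk0]
    have h1 := congrArg natDegree hk
    rw [natDegree_sub_C, natDegree_mul (X_sub_C_ne_zero 1) hk0, natDegree_X_sub_C] at h1
    omega

section
variable {d m : ℕ} {φ : ℝ[X]} (h : IsOrthogonal d m φ)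
include h

/-- The constant is chosen to cancel the coefficient of `X ^ m`, so the left side `G` has degree
below `m`. By self-adjointness and orthogonality the moment of `(1 - X) G ^ 2` vanishes, which
forces `G = 0`. -/
lemma IsOrthogonal.jacobiOp_eq :
    jacobiOp ((d + 1) / 2) φ + C ((m : ℝ) * (m + (d + 1) / 2 + 1)) * φ = 0 := by
  set b : ℝ := (d + 1) / 2 with hb
  set G := jacobiOp b φ + C ((m : ℝ) * (m + b + 1)) * φ with hG
  by_contra hne
  have hdeg : G.degree < m := by
    rw [degree_lt_iff_coeff_zero]
    intro j hj
    have hφ : ∀ i, m < i → φ.coeff i = 0 := fun i hi =>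
      coeff_eq_zero_of_natDegree_lt (h.natDegree_le.trans_lt hi)
    rw [hG, coeff_add, coeff_jacobiOp, coeff_C_mul, hφ (j + 1) (by omega)]
    rcases hj.eq_or_lt with rfl | hj
    · ring
    · rw [hφ j hj]; ring
  have hzero : radialMoment d ((1 - X) * G * G) = 0 := by
    have h1 : (1 - X) * G * G = (1 - X) * jacobiOp b φ * G
        + ((m : ℝ) * (m + b + 1)) • ((1 - X) * φ * G) := by
      rw [smul_eq_C_mul]; nth_rw 1 [hG]; ring
    have h2 : X * (1 - X) ^ 2 * derivative φ * derivative G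
      = X * (1 - X) ^ 2 * derivative G * derivative φ := by ring
    rw [h1, map_add, map_smul, h.orthogonal G hdeg, smul_zero, add_zero, hb, moment_jacobiOp_mul,
      h2, ← moment_jacobiOp_mul, ← h.orthogonal _ (degree_jacobiOp_lt (b := b) hdeg)]
    congr 1
    ring
  refine (moment_pos d (p := (1 - X) * G * G) ?_ fun t ht => ?_).ne' hzero
  · refine mul_ne_zero (mul_ne_zero (fun h0 => ?_) hne) hne
    simpa using congrArg (eval 0) h0
  · rw [mul_assoc, eval_mul, eval_mul]
    have : 0 ≤ 1 - t := sub_nonneg.2 ht.2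
    have := mul_nonneg this (mul_self_nonneg (G.eval t))
    simpa using this

/-- At 1 the second-order terms of the Jacobi equation cancel, leaving a relation between value and
slope. -/
lemma IsOrthogonal.derivative_eval_one :
    2 * (derivative φ).eval 1 = m * (m + (d + 1) / 2 + 1) * φ.eval 1 := by
  have := congrArg (eval 1) h.jacobiOp_eq
  simp only [jacobiOp, eval_add, eval_sub, eval_mul, eval_X, eval_C, eval_zero] at this
  linear_combination -this

/-- Modulo `1 - X` the polynomial `p` is its value at 1, and the remaining multiple of `1 - X` is
orthogonal to `φ`. So `φ` acts as an evaluation kernel at 1. -/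
lemma IsOrthogonal.moment_mul {p : ℝ[X]} (hp : p.natDegree ≤ m) :
    radialMoment d (φ * p) = p.eval 1 * radialMoment d φ := by
  obtain ⟨k, hk, hpk⟩ := exists_sub_eval_one hp
  have : φ * p = p.eval 1 • φ + (1 - X) * φ * k := by
    rw [smul_eq_C_mul]; nth_rw 1 [hpk]; ring
  rw [this, map_add, map_smul, h.orthogonal k hk, add_zero, smul_eq_mul]

lemma IsOrthogonal.eval_one_ne_zero : φ.eval 1 ≠ 0 := by
  intro h0
  obtain ⟨g, hg⟩ := dvd_iff_isRoot.2 h0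
  obtain ⟨t, ht, ht0⟩ := h.exists_root (by rw [natDegree_X_sub_C]; exact one_pos) hg
  rw [eval_sub, eval_X, eval_C] at ht0
  linarith [ht.2]

/-- The reciprocal of the Christoffel number at the endpoint `1`. -/
lemma IsOrthogonal.eval_one_sq :
    φ.eval 1 ^ 2 = (m + 1) * (m + (d + 1) / 2) * radialMoment d (φ ^ 2) := by
  -- The Euler identity for `φ ^ 2` expresses `φ(1) ^ 2` as the moment of `φ` times a polynomial of
  -- degree at most `m`. `moment_mul` reduces that to values at 1, and the slope there is known. The
  -- constant is `b + m (m + b + 1) = (m + 1) (m + b)` with `b = (d + 1) / 2`.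
  have h1 := moment_euler d (φ ^ 2)
  have h2 : C (((d : ℝ) + 1) / 2) * φ ^ 2 + X * derivative (φ ^ 2)
      = φ * (C (((d : ℝ) + 1) / 2) * φ + C 2 * (X * derivative φ)) := by
    rw [derivative_pow]; simp; ring
  have hdeg : (C (((d : ℝ) + 1) / 2) * φ + C 2 * (X * derivative φ)).natDegree ≤ m := by
    refine natDegree_add_le_of_degree_le ((natDegree_C_mul_le _ _).trans h.natDegree_le)
      ((natDegree_C_mul_le _ _).trans ?_)
    rcases Nat.eq_zero_or_pos φ.natDegree with h0 | h0
    · rw [derivative_of_natDegree_zero h0]; simp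
    · have := natDegree_derivative_lt h0.ne'
      have := natDegree_mul_le (p := (X : ℝ[X])) (q := derivative φ)
      have := h.natDegree_le
      rw [natDegree_X] at *
      omega
  rw [h2, h.moment_mul hdeg] at h1
  simp only [eval_add, eval_mul, eval_C, eval_X, eval_pow] at h1
  have h3 : radialMoment d (φ ^ 2) = φ.eval 1 * radialMoment d φ := by
    rw [pow_two, h.moment_mul h.natDegree_le]
  rw [h3, ← h1]
  linear_combination (radialMoment d φ) * h.derivative_eval_one

end

/-- A quadrature with nodes at the roots of `N`, exact up to degree `n`. -/
lemma exists_quadrature (L : ℝ[X] →ₗ[ℝ] ℝ) {T : Finset ℝ} {n : ℕ}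
    (hL : ∀ s : ℝ[X], ((∏ t ∈ T, (X - C t)) * s).natDegree ≤ n → L ((∏ t ∈ T, (X - C t)) * s) = 0)
    (hn : T.card ≤ n + 1) :
    ∃ w : ℝ → ℝ, ∀ p : ℝ[X], p.natDegree ≤ n → L p = ∑ t ∈ T, w t * p.eval t := by
  classical
  refine ⟨fun t => L (Lagrange.basis T id t), fun p hp => ?_⟩
  -- `p` minus its interpolant is a multiple of the node polynomial of degree at most `n`, hence is
  -- annihilated by `L`; the weights are the values of `L` on the Lagrange basis.
  let q := Lagrange.interpolate T id (fun t => p.eval t)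
  have hroot : ∀ t ∈ T, (p - q).eval t = 0 := fun t ht => by
    have := Lagrange.eval_interpolate_at_node (v := id) (fun t => p.eval t)
      Function.injective_id.injOn ht
    rw [eval_sub, sub_eq_zero]
    exact this.symm
  obtain ⟨s, hs⟩ : ∏ t ∈ T, (X - C t) ∣ p - q := by
    refine Finset.prod_dvd_of_coprime ?_ ?_
    · exact fun a _ b _ hab => pairwise_coprime_X_sub_C Function.injective_id hab
    · exact fun t ht => dvd_iff_isRoot.2 (hroot t ht)
  have hq : q.natDegree ≤ n := by
    have := Lagrange.degree_interpolate_lt (v := id) (fun t => p.eval t)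
      (Function.injective_id.injOn (s := (T : Set ℝ)))
    rcases eq_or_ne q 0 with h0 | h0
    · rw [h0, natDegree_zero]; exact Nat.zero_le _
    · have := (natDegree_lt_iff_degree_lt h0).2 this
      omega
  have h0 := hL s (by rw [← hs]; exact (natDegree_sub_le _ _).trans (max_le hp hq))
  rw [← hs, map_sub, sub_eq_zero] at h0
  rw [h0]
  simp only [q, Lagrange.interpolate_apply, _root_.map_sum, ← smul_eq_C_mul, map_smul, smul_eq_mul]
  exact Finset.sum_congr rfl fun t _ => mul_comm _ _

end Radau

/-! ### Gauss–Radau and Gauss–Lobatto rules and the sharp endpoint bound -/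

namespace Radau
open Polynomial Set

/-- The polynomial `q` isolates the node `t`: the quadrature of `q` is the single term `w t * q t`,
and it is positive. -/
lemma weight_pos {d n : ℕ} {T : Finset ℝ} {w : ℝ → ℝ}
    (hw : ∀ p : ℝ[X], p.natDegree ≤ n → radialMoment d p = ∑ t ∈ T, w t * p.eval t)
    {t : ℝ} (ht : t ∈ T) (ht01 : t ∈ Icc (0 : ℝ) 1) {q : ℝ[X]} (hq : q.natDegree ≤ n) (hq0 : q ≠ 0)
    (hpos : ∀ x ∈ Icc (0 : ℝ) 1, 0 ≤ q.eval x) (hz : ∀ x ∈ T, x ≠ t → q.eval x = 0) :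
    0 < w t := by
  have h1 := moment_pos d hq0 hpos
  rw [hw q hq, Finset.sum_eq_single_of_mem t ht (fun x hx hne => by rw [hz x hx hne, mul_zero])] at h1
  exact pos_of_mul_pos_left h1 (hpos t ht01)

lemma natDegree_prod_X_sub_C (S : Finset ℝ) : (∏ t ∈ S, (X - C t)).natDegree = S.card := by
  rw [natDegree_prod_of_monic _ _ (fun t _ => monic_X_sub_C t),
    Finset.sum_congr rfl (fun t _ => natDegree_X_sub_C t), Finset.sum_const, smul_eq_mul, mul_one]

lemma prod_X_sub_C_ne_zero (S : Finset ℝ) : (∏ t ∈ S, (X - C t)) ≠ (0 : ℝ[X]) :=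
  Finset.prod_ne_zero_iff.2 fun t _ => X_sub_C_ne_zero t

lemma one_sub_X_ne_zero : (1 - X : ℝ[X]) ≠ 0 := fun h0 => by
  simpa using congrArg (eval 0) h0

lemma natDegree_one_sub_X : (1 - X : ℝ[X]).natDegree = 1 := by
  rw [← C_1, natDegree_sub, natDegree_X_sub_C]

lemma eval_prod_X_sub_C_eq_zero {S : Finset ℝ} {t : ℝ} (ht : t ∈ S) :
    (∏ s ∈ S, (X - C s)).eval t = 0 := by
  rw [eval_prod]
  exact Finset.prod_eq_zero ht (by simp)

/-- The Gauss–Radau (`ε = 0`) and Gauss–Lobatto (`ε = 1`) quadrature rules, with `m` interior nodes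
and an explicit weight at the endpoint `1`. -/
theorem exists_radau_quadrature (d m ε : ℕ) (hε : ε ≤ 1) :
    ∃ S : Finset ℝ, (∀ t ∈ S, t ∈ Ioo (0 : ℝ) 1) ∧ S.card = m ∧ ∃ (T : Finset ℝ) (w : ℝ → ℝ),
      S ⊆ T ∧ 1 ∉ T ∧ (∀ t ∈ T, t ∈ Icc (0 : ℝ) 1 ∧ 0 < w t) ∧
      (∀ p : ℝ[X], p.natDegree ≤ 2 * m + ε →
        (m + 1) * (m + ε + (d + 1) / 2) * radialMoment d p = p.eval 1 + ∑ t ∈ T, w t * p.eval t) ∧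
      ∃ p : ℝ[X], p.natDegree ≤ 2 * m + ε ∧ (∀ t ∈ Icc (0 : ℝ) 1, 0 ≤ p.eval t) ∧ p ≠ 0 ∧
        p.eval 1 = (m + 1) * (m + ε + (d + 1) / 2) * radialMoment d p := by
  classical
  -- The shift by `2 ε` multiplies the weight by `t ^ ε`, which accounts for the extra node 0 in the
  -- Lobatto case.
  obtain ⟨φ, h⟩ := exists_isOrthogonal (d + 2 * ε) m
  obtain ⟨S, hS, hcard, c, hc, hφ⟩ := h.exists_nodes
  set P : ℝ[X] := ∏ t ∈ S, (X - C t) with hP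
  have h1S : (1 : ℝ) ∉ S := fun h1 => (hS 1 h1).2.ne rfl
  have h0S : (0 : ℝ) ∉ S := fun h1 => (hS 0 h1).1.ne rfl
  set Z : Finset ℝ := if ε = 0 then ∅ else {0} with hZ
  have hZ0 : ∀ t ∈ Z, t = 0 ∧ ε = 1 := by
    intro t ht
    rcases Nat.le_one_iff_eq_zero_or_eq_one.1 hε with rfl | rfl
    · simp [hZ] at ht
    · simpa [hZ] using ht
  have hZprod : ∏ t ∈ Z, (X - C t) = (X : ℝ[X]) ^ ε := by
    rcases Nat.le_one_iff_eq_zero_or_eq_one.1 hε with rfl | rfl <;> simp [hZ]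
  have hZcard : Z.card = ε := by
    rcases Nat.le_one_iff_eq_zero_or_eq_one.1 hε with rfl | rfl <;> simp [hZ]
  have hdisj : Disjoint Z S := Finset.disjoint_left.2 fun t ht hts => h0S ((hZ0 t ht).1 ▸ hts)
  set T : Finset ℝ := Z ∪ S with hT
  have h1T : (1 : ℝ) ∉ T := by
    rw [hT, Finset.mem_union, not_or]
    exact ⟨fun h1 => one_ne_zero (hZ0 1 h1).1, h1S⟩
  have hTprod : ∏ t ∈ insert 1 T, (X - C t) = -((1 - X) * (X ^ ε * P)) := by
    rw [Finset.prod_insert h1T, hT, Finset.prod_union hdisj, hZprod, C_1]; ring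
  have hTcard : (insert 1 T).card = m + ε + 1 := by
    rw [Finset.card_insert_of_notMem h1T, hT, Finset.card_union_of_disjoint hdisj, hZcard, hcard,
      add_comm ε]
  have hPdeg : P.natDegree = m := by rw [hP, natDegree_prod_X_sub_C, hcard]
  have hP0 : P ≠ 0 := prod_X_sub_C_ne_zero S
  obtain ⟨w, hw⟩ := exists_quadrature (radialMoment d) (T := insert 1 T) (n := 2 * m + ε)
    (by
      intro s hs
      rcases eq_or_ne s 0 with rfl | hs0
      · simp
      rw [natDegree_mul (prod_X_sub_C_ne_zero _) hs0, natDegree_prod_X_sub_C, hTcard] at hs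
      -- The degree bound leaves `deg s < m`, so the product is `X ^ ε` times a polynomial
      -- annihilated by the shifted functional.
      have : (∏ t ∈ insert 1 T, (X - C t)) * s = (-c⁻¹) • (X ^ ε * ((1 - X) * φ * s)) := by
        have hcc : (C c⁻¹ : ℝ[X]) * C c = 1 := by rw [← C_mul, inv_mul_cancel₀ hc, C_1]
        rw [hTprod, smul_eq_C_mul, hφ, C_neg]
        linear_combination (X ^ ε * (1 - X) * P * s) * hcc
      rw [this, map_smul, moment_X_pow_mul, h.orthogonal, smul_zero]
      rw [← natDegree_lt_iff_degree_lt hs0]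
      omega) (by omega)
  set M : ℝ := (m + 1) * (m + ε + (d + 1) / 2) with hM
  have hMpos : 0 < M := by positivity
  have hT01 : ∀ t ∈ T, t ∈ Icc (0 : ℝ) 1 := by
    intro t ht
    rcases Finset.mem_union.1 ht with ht | ht
    · rw [(hZ0 t ht).1]; simp
    · exact Ioo_subset_Icc_self (hS t ht)
  have hPsq : ∀ t : ℝ, 0 ≤ P.eval t ^ 2 := fun t => sq_nonneg _
  have hpos : ∀ t ∈ T, 0 < w t := by
    intro t ht
    rcases Finset.mem_union.1 ht with htZ | htS
    · refine weight_pos hw (Finset.mem_insert_of_mem ht) (hT01 t ht) (q := (1 - X) * P ^ 2) ?_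
        (mul_ne_zero one_sub_X_ne_zero (pow_ne_zero 2 hP0)) ?_ ?_
      · have := natDegree_mul_le (p := (1 - X : ℝ[X])) (q := P ^ 2)
        rw [natDegree_one_sub_X, natDegree_pow, hPdeg] at this
        have := (hZ0 t htZ).2
        omega
      · intro x hx
        rw [eval_mul, eval_pow, eval_sub, eval_one, eval_X]
        exact mul_nonneg (sub_nonneg.2 hx.2) (hPsq x)
      · intro x hx hne
        rcases Finset.mem_insert.1 hx with rfl | hx
        · simp
        rcases Finset.mem_union.1 hx with hx | hx
        · exact absurd ((hZ0 x hx).1.trans (hZ0 t htZ).1.symm) hne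
        · rw [eval_mul, eval_pow, hP, eval_prod_X_sub_C_eq_zero hx]; simp
    · refine weight_pos hw (Finset.mem_insert_of_mem ht) (hT01 t ht)
        (q := X ^ ε * ((1 - X) * (∏ s ∈ S.erase t, (X - C s)) ^ 2)) ?_
        (mul_ne_zero (pow_ne_zero _ X_ne_zero)
          (mul_ne_zero one_sub_X_ne_zero (pow_ne_zero 2 (prod_X_sub_C_ne_zero _)))) ?_ ?_
      · rw [natDegree_mul (pow_ne_zero _ X_ne_zero)
            (mul_ne_zero one_sub_X_ne_zero (pow_ne_zero 2 (prod_X_sub_C_ne_zero _))),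
          natDegree_mul one_sub_X_ne_zero (pow_ne_zero 2 (prod_X_sub_C_ne_zero _)), natDegree_X_pow,
          natDegree_one_sub_X, natDegree_pow, natDegree_prod_X_sub_C, Finset.card_erase_of_mem htS]
        have := Finset.card_pos.2 ⟨t, htS⟩
        omega
      · intro x hx
        rw [eval_mul, eval_mul, eval_pow, eval_pow, eval_sub, eval_one, eval_X]
        exact mul_nonneg (pow_nonneg hx.1 _) (mul_nonneg (sub_nonneg.2 hx.2) (sq_nonneg _))
      · intro x hx hne
        rcases Finset.mem_insert.1 hx with rfl | hx
        · simp
        rcases Finset.mem_union.1 hx with hx | hx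
        · rw [(hZ0 x hx).1, (hZ0 x hx).2]; simp
        · rw [eval_mul, eval_mul, eval_pow 2,
            eval_prod_X_sub_C_eq_zero (Finset.mem_erase.2 ⟨hne, hx⟩)]; simp
  have hext : (X ^ ε * φ ^ 2).natDegree ≤ 2 * m + ε := by
    have := natDegree_mul_le (p := (X : ℝ[X]) ^ ε) (q := φ ^ 2)
    rw [natDegree_X_pow, natDegree_pow, h.natDegree_eq] at this
    omega
  have hval := h.eval_one_sq
  rw [← moment_X_pow_mul] at hval
  push_cast at hval
  have hval' : φ.eval 1 ^ 2 = M * radialMoment d (X ^ ε * φ ^ 2) := by rw [hval, hM]; ring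
  -- `X ^ ε * φ ^ 2` vanishes at every node but 1, so its quadrature sees only `w 1`; `eval_one_sq`
  -- gives its moment.
  have hw1 : M * w 1 = 1 := by
    have h1 := hw _ hext
    rw [Finset.sum_eq_single_of_mem 1 (Finset.mem_insert_self _ _)] at h1
    · rw [h1] at hval'
      simp only [eval_mul, eval_pow, eval_X, one_pow, one_mul] at hval'
      refine mul_right_cancel₀ (pow_ne_zero 2 h.eval_one_ne_zero) ?_
      linear_combination -hval'
    · intro x hx hne
      rcases Finset.mem_insert.1 hx with rfl | hx
      · exact absurd rfl hne
      rcases Finset.mem_union.1 hx with hx | hx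
      · rw [(hZ0 x hx).1, (hZ0 x hx).2]; simp
      · rw [eval_mul, eval_pow 2, hφ, eval_mul, eval_prod_X_sub_C_eq_zero hx]; simp
  refine ⟨S, hS, hcard, T, fun t => M * w t, Finset.subset_union_right, h1T,
    fun t ht => ⟨hT01 t ht, mul_pos hMpos (hpos t ht)⟩, fun p hp => ?_, X ^ ε * φ ^ 2, hext,
    fun t ht => ?_, mul_ne_zero (pow_ne_zero _ X_ne_zero) (pow_ne_zero 2 h.ne_zero), ?_⟩
  · rw [hw p hp, Finset.sum_insert h1T, mul_add, Finset.mul_sum, ← mul_assoc, hw1, one_mul]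
    simp only [mul_assoc]
  · rw [eval_mul, eval_pow, eval_pow, eval_X]
    exact mul_nonneg (pow_nonneg ht.1 _) (sq_nonneg _)
  · rw [← hval']; simp

/-- The sharp endpoint bound for polynomials that are nonnegative on `[0, 1]`. -/
theorem exists_endpoint_bound (d n : ℕ) :
    ∃ S : Finset ℝ, (∀ t ∈ S, t ∈ Ioo (0 : ℝ) 1) ∧ S.card = n / 2 ∧
      (∀ p : ℝ[X], p.natDegree ≤ n → (∀ t ∈ Icc (0 : ℝ) 1, 0 ≤ p.eval t) →
        p.eval 1 ≤ (((n / 2 : ℕ) : ℝ) + 1) * (((n + 1) / 2 : ℕ) + ((d : ℝ) + 1) / 2)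
          * radialMoment d p ∧
        (p.eval 1 = (((n / 2 : ℕ) : ℝ) + 1) * (((n + 1) / 2 : ℕ) + ((d : ℝ) + 1) / 2)
          * radialMoment d p → ∀ t ∈ S, p.eval t = 0)) ∧
      ∃ p : ℝ[X], p.natDegree ≤ n ∧ (∀ t ∈ Icc (0 : ℝ) 1, 0 ≤ p.eval t) ∧ p ≠ 0 ∧
        p.eval 1 = (((n / 2 : ℕ) : ℝ) + 1) * (((n + 1) / 2 : ℕ) + ((d : ℝ) + 1) / 2)
          * radialMoment d p := by
  have hn : 2 * (n / 2) + n % 2 = n := Nat.div_add_mod n 2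
  have hn' : (((n + 1) / 2 : ℕ) : ℝ) = ((n / 2 : ℕ) : ℝ) + ((n % 2 : ℕ) : ℝ) := by
    exact_mod_cast (by omega : (n + 1) / 2 = n / 2 + n % 2)
  obtain ⟨S, hS, hcard, T, w, hST, -, hT, hq, hex⟩ :=
    exists_radau_quadrature d (n / 2) (n % 2) (by omega)
  rw [hn] at hq hex
  rw [hn']
  refine ⟨S, hS, hcard, fun p hp hpos => ?_, hex⟩
  rw [hq p hp]
  have hterm : ∀ t ∈ T, 0 ≤ w t * p.eval t := fun t ht =>
    mul_nonneg (hT t ht).2.le (hpos t (hT t ht).1)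
  refine ⟨le_add_of_nonneg_right (Finset.sum_nonneg hterm), fun heq t ht => ?_⟩
  -- In the equality case every nonnegative term of the sum vanishes, and the weights are positive.
  have h0 : ∑ t ∈ T, w t * p.eval t = 0 := by linarith
  have := (Finset.sum_eq_zero_iff_of_nonneg hterm).1 h0 t (hST ht)
  exact (mul_eq_zero.1 this).resolve_left (hT t (hST ht)).2.ne'

end Radau

/-! ### Dilations and the reduction to one variable -/

lemma eval_aeval {D : ℕ} (f : Fin D → MvPolynomial (Fin D) ℝ) (z : Fin D → ℝ)
    (U : MvPolynomial (Fin D) ℝ) : MvPolynomial.eval z (MvPolynomial.aeval f U) =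
      MvPolynomial.eval (fun i => MvPolynomial.eval z (f i)) U := by
  induction U using MvPolynomial.induction_on with
  | C a => rw [MvPolynomial.aeval_C, MvPolynomial.algebraMap_eq, MvPolynomial.eval_C,
      MvPolynomial.eval_C]
  | add p q hp hq => rw [map_add, map_add, map_add, hp, hq]
  | mul_X p i hp => rw [map_mul, map_mul, map_mul, hp, MvPolynomial.aeval_X, MvPolynomial.eval_X]

lemma aeval_mem_polySpace {D k : ℕ} {f : Fin D → MvPolynomial (Fin D) ℝ}
    (hf : ∀ i, (f i).totalDegree ≤ 1) {U : MvPolynomial (Fin D) ℝ} (hU : U ∈ polySpace D k) :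
    MvPolynomial.aeval f U ∈ polySpace D k := by
  rw [MvPolynomial.mem_restrictTotalDegree] at hU
  rw [MvPolynomial.as_sum U, _root_.map_sum]
  refine Submodule.sum_mem _ fun α hα => ?_
  rw [MvPolynomial.mem_restrictTotalDegree, MvPolynomial.aeval_monomial,
    MvPolynomial.algebraMap_eq]
  refine (MvPolynomial.totalDegree_mul _ _).trans ?_
  rw [MvPolynomial.totalDegree_C, zero_add]
  refine (MvPolynomial.totalDegree_finsetProd _ _).trans (le_trans ?_
    ((MvPolynomial.le_totalDegree hα).trans hU))
  exact Finset.sum_le_sum fun i _ => (MvPolynomial.totalDegree_pow _ _).trans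
    ((Nat.mul_le_mul_left _ (hf i)).trans (mul_one _).le)

/-- The polynomial `x ↦ U (r • x)`. -/
def dilate {D : ℕ} (r : ℝ) : MvPolynomial (Fin D) ℝ →ₐ[ℝ] MvPolynomial (Fin D) ℝ :=
  MvPolynomial.aeval fun i => MvPolynomial.C r * MvPolynomial.X i

lemma polyEval_dilate {D : ℕ} (r : ℝ) (U : MvPolynomial (Fin D) ℝ)
    (x : EuclideanSpace ℝ (Fin D)) : polyEval (dilate r U) x = polyEval U (r • x) := by
  rw [polyEval, dilate, eval_aeval, polyEval]
  simp

lemma dilate_monomial {D : ℕ} (r : ℝ) (α : Fin D →₀ ℕ) :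
    dilate r (MvPolynomial.monomial α 1) = r ^ α.degree • MvPolynomial.monomial α (1 : ℝ) := by
  rw [dilate, MvPolynomial.aeval_monomial, map_one, one_mul, MvPolynomial.monomial_eq,
    Finsupp.prod, Finsupp.prod, Finsupp.degree_apply, MvPolynomial.C_1, one_mul, Algebra.smul_def,
    MvPolynomial.algebraMap_eq, ← Finset.prod_pow_eq_pow_sum, map_prod, ← Finset.prod_mul_distrib]
  simp only [mul_pow, map_pow]

/-- The relation between the boundary average `B` and the cell average `C` on a centrally symmetric
cell all of whose supporting hyperplanes have unit distance from the centre. -/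
structure RadialPair {d : ℕ} (B C : MvPolynomial (Fin (d + 1)) ℝ →ₗ[ℝ] ℝ) : Prop where
  scale : ∀ α : Fin (d + 1) →₀ ℕ, ((α.degree : ℝ) + (d + 1)) * C (MvPolynomial.monomial α 1) =
    (d + 1) * B (MvPolynomial.monomial α 1)
  odd : ∀ α : Fin (d + 1) →₀ ℕ, Odd α.degree → B (MvPolynomial.monomial α 1) = 0

open Polynomial in
/-- The polynomial `p` with `p (r ^ 2) = B (U (r • ·))`. -/
def radialProfile {D : ℕ} (B : MvPolynomial (Fin D) ℝ →ₗ[ℝ] ℝ) :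
    MvPolynomial (Fin D) ℝ →ₗ[ℝ] ℝ[X] :=
  (MvPolynomial.basisMonomials (Fin D) ℝ).constr ℝ fun α =>
    B (MvPolynomial.monomial α 1) • X ^ (α.degree / 2)

lemma radialProfile_monomial {D : ℕ} (B : MvPolynomial (Fin D) ℝ →ₗ[ℝ] ℝ) (α : Fin D →₀ ℕ) :
    radialProfile B (MvPolynomial.monomial α 1) =
      B (MvPolynomial.monomial α 1) • Polynomial.X ^ (α.degree / 2) := by
  have := (MvPolynomial.basisMonomials (Fin D) ℝ).constr_basis ℝ
    (fun α => B (MvPolynomial.monomial α 1) • (Polynomial.X : Polynomial ℝ) ^ (α.degree / 2)) α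
  rwa [MvPolynomial.coe_basisMonomials] at this

/-- This halving of the degree is why the degrees `2 n` and `2 n + 1` give the same weight. -/
lemma natDegree_radialProfile_le {D k : ℕ} (B : MvPolynomial (Fin D) ℝ →ₗ[ℝ] ℝ)
    {U : MvPolynomial (Fin D) ℝ} (hU : U ∈ polySpace D k) :
    (radialProfile B U).natDegree ≤ k / 2 := by
  rw [MvPolynomial.mem_restrictTotalDegree] at hU
  rw [MvPolynomial.as_sum U, _root_.map_sum]
  refine Polynomial.natDegree_sum_le_of_forall_le _ _ fun α hα => ?_
  rw [← mul_one (MvPolynomial.coeff α U), ← smul_eq_mul, ← MvPolynomial.smul_monomial, map_smul,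
    radialProfile_monomial, smul_smul]
  refine (Polynomial.natDegree_smul_le _ _).trans ?_
  rw [Polynomial.natDegree_X_pow]
  exact Nat.div_le_div_right ((MvPolynomial.le_totalDegree hα).trans hU)

lemma linearMap_eq_of_monomial {D : ℕ} {M : Type*} [AddCommMonoid M] [Module ℝ M]
    {f g : MvPolynomial (Fin D) ℝ →ₗ[ℝ] M}
    (h : ∀ α, f (MvPolynomial.monomial α 1) = g (MvPolynomial.monomial α 1)) : f = g :=
  (MvPolynomial.basisMonomials (Fin D) ℝ).ext fun α => by
    simpa only [MvPolynomial.coe_basisMonomials] using h α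

/-- The optimal interior weight of the ball in dimension `d + 1`, for degrees `2 n` and `2 n + 1`. -/
def ballWeight (d n : ℕ) : ℝ :=
  (((n / 2 : ℕ) : ℝ) + 1) * (2 * (((n + 1) / 2 : ℕ) : ℝ) + ((d + 1 : ℕ) : ℝ)) / ((d + 1 : ℕ) : ℝ)

lemma ballWeight_mul (d n : ℕ) (a : ℝ) :
    (((n / 2 : ℕ) : ℝ) + 1) * (((n + 1) / 2 : ℕ) + ((d : ℝ) + 1) / 2) * a =
      ballWeight d n * ((d + 1) / 2 * a) := by
  rw [ballWeight]
  push_cast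
  field_simp

namespace RadialPair
variable {d : ℕ} {B C : MvPolynomial (Fin (d + 1)) ℝ →ₗ[ℝ] ℝ} (h : RadialPair B C)
include h

/-- Odd monomials, for which the exponent `α.degree / 2` is rounded down, do no harm because `B`
kills them. -/
lemma eval_radialProfile (U : MvPolynomial (Fin (d + 1)) ℝ) (r : ℝ) :
    (radialProfile B U).eval (r ^ 2) = B (dilate r U) := by
  have : (Polynomial.leval (r ^ 2)) ∘ₗ radialProfile B = B ∘ₗ (dilate r).toLinearMap := by
    refine linearMap_eq_of_monomial fun α => ?_
    simp only [LinearMap.comp_apply, Polynomial.leval_apply, AlgHom.toLinearMap_apply]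
    rw [radialProfile_monomial, dilate_monomial, map_smul, Polynomial.eval_smul,
      Polynomial.eval_pow, Polynomial.eval_X, smul_eq_mul, smul_eq_mul]
    rcases Nat.even_or_odd α.degree with he | ho
    · rw [← pow_mul, Nat.mul_div_cancel' he.two_dvd, mul_comm]
    · rw [h.odd α ho, mul_zero, zero_mul]
  exact LinearMap.congr_fun this U

lemma eval_one_radialProfile (U : MvPolynomial (Fin (d + 1)) ℝ) :
    (radialProfile B U).eval 1 = B U := by
  rw [← one_pow 2, h.eval_radialProfile]
  congr 1
  simp [dilate]

/-- The layer formula `C U = (d + 1) ∫₀¹ r ^ d B (U (r •)) dr`, checked on monomials, where it is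
the relation `scale`. -/
lemma radialMoment_radialProfile (U : MvPolynomial (Fin (d + 1)) ℝ) :
    (d + 1) / 2 * radialMoment d (radialProfile B U) = C U := by
  have : (((d : ℝ) + 1) / 2) • (radialMoment d ∘ₗ radialProfile B) = C := by
    refine linearMap_eq_of_monomial fun α => ?_
    have hs := h.scale α
    rw [LinearMap.smul_apply, LinearMap.comp_apply, radialProfile_monomial, map_smul,
      Radau.moment_X_pow, smul_eq_mul, smul_eq_mul]
    have hpos : (0 : ℝ) < (α.degree : ℝ) + (d + 1) := by positivity
    rcases Nat.even_or_odd α.degree with ⟨e, he⟩ | ho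
    · have h2 : α.degree / 2 = e := by omega
      have h3 : (α.degree : ℝ) = 2 * e := by rw [he]; push_cast; ring
      rw [h2]
      rw [h3] at hs hpos
      have : (e : ℝ) + (d + 1) / 2 ≠ 0 := by linarith
      field_simp
      linarith
    · rw [h.odd α ho, zero_mul, mul_zero]
      rw [h.odd α ho, mul_zero] at hs
      exact ((mul_eq_zero.1 hs).resolve_left hpos.ne').symm
  exact LinearMap.congr_fun this U

omit h in
lemma _root_.eval_nonneg_of_eval_sq {p : Polynomial ℝ} {f : ℝ → ℝ} (hf : ∀ r, p.eval (r ^ 2) = f r)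
    (hpos : ∀ r ∈ Set.Icc (0 : ℝ) 1, 0 ≤ f r) : ∀ t ∈ Set.Icc (0 : ℝ) 1, 0 ≤ p.eval t := by
  intro t ht
  rw [← Real.sq_sqrt ht.1, hf]
  exact hpos _ ⟨Real.sqrt_nonneg t, Real.sqrt_le_one.2 ht.2⟩

/-- The sharp bound of the boundary average by the cell average, and its equality case. -/
theorem exists_le (n : ℕ) : ∃ S : Finset ℝ, (∀ r ∈ S, r ∈ Set.Ioo (0 : ℝ) 1) ∧ S.card = n / 2 ∧
    ∀ U ∈ polySpace (d + 1) (2 * n + 1), (∀ r ∈ Set.Icc (0 : ℝ) 1, 0 ≤ B (dilate r U)) →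
      B U ≤ ballWeight d n * C U ∧ (B U = ballWeight d n * C U → ∀ r ∈ S, B (dilate r U) = 0) := by
  classical
  obtain ⟨S, hS, hcard, hle, -⟩ := Radau.exists_endpoint_bound d n
  refine ⟨S.image Real.sqrt, fun r hr => ?_, ?_, fun U hU hpos => ?_⟩
  · obtain ⟨t, ht, rfl⟩ := Finset.mem_image.1 hr
    exact ⟨Real.sqrt_pos.2 (hS t ht).1, (Real.sqrt_lt' one_pos).2 (by simpa using (hS t ht).2)⟩
  · rw [Finset.card_image_of_injOn, hcard]
    intro s hs t ht hst
    exact (Real.sqrt_inj (hS s hs).1.le (hS t ht).1.le).1 hst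
  · have hdeg := natDegree_radialProfile_le B hU
    rw [show (2 * n + 1) / 2 = n by omega] at hdeg
    obtain ⟨h1, h2⟩ := hle (radialProfile B U) hdeg
      (eval_nonneg_of_eval_sq (h.eval_radialProfile U) hpos)
    rw [ballWeight_mul, h.radialMoment_radialProfile, h.eval_one_radialProfile] at h1 h2
    refine ⟨h1, fun heq r hr => ?_⟩
    obtain ⟨t, ht, rfl⟩ := Finset.mem_image.1 hr
    rw [← h.eval_radialProfile, Real.sq_sqrt (hS t ht).1.le]
    exact h2 heq t ht

end RadialPair

/-! ### Averages of polynomials as linear functionals -/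

section
variable {D : ℕ}

@[fun_prop]
lemma continuous_polyEval (U : MvPolynomial (Fin D) ℝ) : Continuous (polyEval U) := by
  unfold polyEval
  exact (MvPolynomial.continuous_eval U).comp (by fun_prop)

lemma IsCompact.integrableOn_polyEval {A : Set (EuclideanSpace ℝ (Fin D))} (hA : IsCompact A)
    {μ : Measure (EuclideanSpace ℝ (Fin D))} (hμ : μ A ≠ ⊤) (U : MvPolynomial (Fin D) ℝ) :
    IntegrableOn (polyEval U) A μ := by
  obtain ⟨c, hc⟩ := hA.exists_bound_of_continuousOn (continuous_polyEval U).continuousOn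
  exact Measure.integrableOn_of_bounded hμ
    (continuous_polyEval U).aestronglyMeasurable
    ((ae_restrict_iff' hA.measurableSet).2 (ae_of_all _ hc))

/-- The average of polynomials over a compact set of finite measure. -/
def averageFunctional {A : Set (EuclideanSpace ℝ (Fin D))} (hA : IsCompact A)
    {μ : Measure (EuclideanSpace ℝ (Fin D))} (hμ : μ A ≠ ⊤) :
    MvPolynomial (Fin D) ℝ →ₗ[ℝ] ℝ where
  toFun U := ⨍ x in A, polyEval U x ∂μ
  map_add' U V := by
    simp only [setAverage_eq]
    rw [← smul_add, ← integral_add (hA.integrableOn_polyEval hμ U) (hA.integrableOn_polyEval hμ V)]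
    simp only [polyEval, map_add]
  map_smul' c U := by
    simp only [setAverage_eq, RingHom.id_apply]
    rw [smul_comm, ← integral_smul c]
    simp only [polyEval, MvPolynomial.smul_eval, smul_eq_mul c]

lemma averageFunctional_apply {A : Set (EuclideanSpace ℝ (Fin D))} (hA : IsCompact A)
    {μ : Measure (EuclideanSpace ℝ (Fin D))} (hμ : μ A ≠ ⊤) (U : MvPolynomial (Fin D) ℝ) :
    averageFunctional hA hμ U = ⨍ x in A, polyEval U x ∂μ := rfl

lemma averageFunctional_nonneg {A : Set (EuclideanSpace ℝ (Fin D))} (hA : IsCompact A)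
    {μ : Measure (EuclideanSpace ℝ (Fin D))} (hμ : μ A ≠ ⊤) {U : MvPolynomial (Fin D) ℝ}
    (hU : ∀ x ∈ A, 0 ≤ polyEval U x) : 0 ≤ averageFunctional hA hμ U := by
  rw [averageFunctional_apply, setAverage_eq]
  exact smul_nonneg (inv_nonneg.2 measureReal_nonneg) (setIntegral_nonneg hA.measurableSet hU)

lemma averageFunctional_congr {A : Set (EuclideanSpace ℝ (Fin D))} (hA : IsCompact A)
    {μ : Measure (EuclideanSpace ℝ (Fin D))} (hμ : μ A ≠ ⊤) {U V : MvPolynomial (Fin D) ℝ}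
    (h : ∀ x ∈ A, polyEval U x = polyEval V x) :
    averageFunctional hA hμ U = averageFunctional hA hμ V := by
  rw [averageFunctional_apply, averageFunctional_apply, setAverage_eq, setAverage_eq,
    setIntegral_congr_fun hA.measurableSet h]

lemma averageFunctional_one {A : Set (EuclideanSpace ℝ (Fin D))} (hA : IsCompact A)
    {μ : Measure (EuclideanSpace ℝ (Fin D))} (hμ : μ A ≠ ⊤) (h0 : μ A ≠ 0) :
    averageFunctional hA hμ 1 = 1 := by
  have : ∀ x : EuclideanSpace ℝ (Fin D), polyEval 1 x = 1 := fun x => by simp [polyEval]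
  rw [averageFunctional_apply]
  simp only [this]
  exact setAverage_const h0 hμ 1

end

/-! ### The faces of the unit box and their Hausdorff measure -/

section
variable {d : ℕ}

/-- The Hausdorff measure of full dimension is a multiple of Lebesgue measure. -/
lemma exists_hausdorffMeasure_eq_smul (d : ℕ) : ∃ c : NNReal, c ≠ 0 ∧
    (μH[(d : ℝ)] : Measure (EuclideanSpace ℝ (Fin d))) = c • volume := by
  have : IsAddHaarMeasure (μH[(d : ℝ)] : Measure (EuclideanSpace ℝ (Fin d))) := by
    have := isAddHaarMeasure_hausdorffMeasure (E := EuclideanSpace ℝ (Fin d))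
    rwa [finrank_euclideanSpace_fin] at this
  refine ⟨_, ?_, isAddLeftInvariant_eq_smul (μH[(d : ℝ)] : Measure (EuclideanSpace ℝ (Fin d))) volume⟩
  exact (addHaarScalarFactor_pos_of_isAddHaarMeasure _ _).ne'

lemma isCompact_boxCell (D : ℕ) : IsCompact (boxCell D) := by
  have : boxCell D = (EuclideanSpace.equiv (Fin D) ℝ) ⁻¹' (Set.pi Set.univ fun _ => Set.Icc 0 1) := by
    ext x; simp only [boxCell, Set.mem_preimage, Set.mem_pi, Set.mem_univ, true_imp_iff, Set.mem_ofPred_eq]; rfl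
  rw [this]
  exact (EuclideanSpace.equiv (Fin D) ℝ).toHomeomorph.isCompact_preimage.2
    (isCompact_univ_pi fun _ => isCompact_Icc)

lemma mem_frontier_boxCell {D : ℕ} {x : EuclideanSpace ℝ (Fin D)} :
    x ∈ frontier (boxCell D) ↔ x ∈ boxCell D ∧ ∃ i, x i = 0 ∨ x i = 1 := by
  have h : boxCell D = (EuclideanSpace.equiv (Fin D) ℝ).toHomeomorph ⁻¹'
      (Set.pi Set.univ fun _ => Set.Icc 0 1) := by
    ext x; simp only [boxCell, Set.mem_preimage, Set.mem_pi, Set.mem_univ, true_imp_iff, Set.mem_ofPred_eq]; rfl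
  have hi : x ∈ interior (boxCell D) ↔ ∀ i, x i ∈ Set.Ioo (0 : ℝ) 1 := by
    rw [h, ← Homeomorph.preimage_interior, interior_pi_set Set.finite_univ]
    simp
  rw [(isCompact_boxCell D).isClosed.frontier_eq, Set.mem_sdiff, hi]
  refine and_congr_right fun hx => ?_
  push Not
  refine exists_congr fun i => ?_
  have := hx i
  simp only [Set.mem_Ioo, Set.mem_Icc] at this ⊢
  constructor
  · intro h
    by_contra! h'
    exact h ⟨lt_of_le_of_ne this.1 (Ne.symm h'.1), lt_of_le_of_ne this.2 h'.2⟩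
  · rintro (h | h) <;> rw [h] <;> simp

/-- The parametrization of the hyperplane `x i = s`. -/
def faceMap (i : Fin (d + 1)) (s : ℝ) (y : EuclideanSpace ℝ (Fin d)) :
    EuclideanSpace ℝ (Fin (d + 1)) := WithLp.toLp 2 (i.insertNth s (fun j => y j))

@[simp] lemma faceMap_same (i : Fin (d + 1)) (s : ℝ) (y : EuclideanSpace ℝ (Fin d)) :
    faceMap i s y i = s := by simp [faceMap]

@[simp] lemma faceMap_succAbove (i : Fin (d + 1)) (s : ℝ) (y : EuclideanSpace ℝ (Fin d)) (j) :
    faceMap i s y (i.succAbove j) = y j := by simp [faceMap]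

lemma isometry_faceMap (i : Fin (d + 1)) (s : ℝ) : Isometry (faceMap (d := d) i s) := by
  refine Isometry.of_dist_eq fun x y => ?_
  rw [EuclideanSpace.dist_eq, EuclideanSpace.dist_eq, Fin.sum_univ_succAbove _ i]
  simp

lemma faceMap_mem_boxCell {i : Fin (d + 1)} {s : ℝ} (hs : s ∈ Set.Icc (0 : ℝ) 1)
    {y : EuclideanSpace ℝ (Fin d)} (hy : y ∈ boxCell d) : faceMap i s y ∈ boxCell (d + 1) := by
  intro j
  rcases Fin.eq_self_or_eq_succAbove i j with rfl | ⟨j, rfl⟩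
  · simpa using hs
  · simpa using hy j

lemma exists_faceMap_eq (i : Fin (d + 1)) {x : EuclideanSpace ℝ (Fin (d + 1))}
    (hx : x ∈ boxCell (d + 1)) : ∃ y ∈ boxCell d, faceMap i (x i) y = x := by
  refine ⟨WithLp.toLp 2 fun j => x (i.succAbove j), fun j => hx _, ?_⟩
  ext j
  rcases Fin.eq_self_or_eq_succAbove i j with rfl | ⟨j, rfl⟩ <;> simp

/-- The face of the unit box in which the coordinate `p.1` is `p.2`. -/
def boxFace (p : Fin (d + 1) × Fin 2) : Set (EuclideanSpace ℝ (Fin (d + 1))) :=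
  faceMap p.1 (p.2 : ℕ) '' boxCell d

lemma frontier_boxCell : frontier (boxCell (d + 1)) = ⋃ p, boxFace (d := d) p := by
  ext x
  rw [mem_frontier_boxCell, Set.mem_iUnion]
  constructor
  · rintro ⟨hx, i, hi⟩
    obtain ⟨y, hy, hyx⟩ := exists_faceMap_eq i hx
    rcases hi with hi | hi
    · exact ⟨(i, 0), y, hy, by rw [← hyx, hi]; simp⟩
    · exact ⟨(i, 1), y, hy, by rw [← hyx, hi]; simp⟩
  · rintro ⟨⟨i, s⟩, y, hy, rfl⟩
    refine ⟨faceMap_mem_boxCell ?_ hy, i, ?_⟩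
    · fin_cases s <;> simp
    · fin_cases s <;> simp

lemma hausdorffMeasure_hyperplane (j : Fin d) (s : ℝ) :
    μH[(d : ℝ)] {y : EuclideanSpace ℝ (Fin d) | y j = s} = 0 := by
  obtain ⟨c, -, hc⟩ := exists_hausdorffMeasure_eq_smul d
  have : volume {y : EuclideanSpace ℝ (Fin d) | y j = s} = 0 := by
    have h1 : {y : EuclideanSpace ℝ (Fin d) | y j = s} =
      (WithLp.ofLp (p := 2) (V := Fin d → ℝ)) ⁻¹' {z | z j = s} := rfl
    rw [h1, (PiLp.volume_preserving_ofLp (Fin d)).measure_preimage_emb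
      (MeasurableEquiv.toLp 2 (Fin d → ℝ)).symm.measurableEmbedding]
    exact Measure.pi_hyperplane (α := fun _ => ℝ) (fun _ => volume) j s
  rw [hc, Measure.smul_apply, this, smul_zero]

/-- Opposite faces are disjoint. Two other faces meet inside the isometric image of a coordinate
hyperplane of `ℝ ^ d`, which is null. -/
lemma aedisjoint_boxFace :
    Pairwise (Function.onFun (AEDisjoint (μH[(d : ℝ)])) (boxFace (d := d))) := by
  rintro ⟨i, s⟩ ⟨j, t⟩ hne
  by_cases hij : i = j
  · subst hij
    have hst : s ≠ t := fun h => hne (by rw [h])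
    refine Disjoint.aedisjoint (Set.disjoint_left.2 ?_)
    rintro _ ⟨y, -, rfl⟩ ⟨z, -, hz⟩
    have := congrArg (fun x : EuclideanSpace ℝ (Fin (d + 1)) => x i) hz
    simp only [faceMap_same] at this
    exact hst (Fin.ext (by exact_mod_cast this.symm))
  · obtain ⟨j', rfl⟩ := (Fin.eq_self_or_eq_succAbove i j).resolve_left (Ne.symm hij)
    refine measure_mono_null (t := faceMap i (s : ℕ) '' {y | y j' = ((t : ℕ) : ℝ)}) ?_ ?_
    · rintro _ ⟨⟨y, -, rfl⟩, ⟨z, -, hz⟩⟩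
      refine ⟨y, ?_, rfl⟩
      have := congrArg (fun x : EuclideanSpace ℝ (Fin (d + 1)) => x (i.succAbove j')) hz
      simp only [faceMap_same, faceMap_succAbove] at this
      exact this.symm
    · rw [(isometry_faceMap i _).hausdorffMeasure_image (Or.inl (Nat.cast_nonneg d)),
        hausdorffMeasure_hyperplane]

lemma measurableSet_boxFace (p : Fin (d + 1) × Fin 2) : MeasurableSet (boxFace (d := d) p) :=
  ((isCompact_boxCell d).image (isometry_faceMap _ _).continuous).measurableSet

lemma restrict_frontier_boxCell :
    (μH[(d : ℝ)] : Measure (EuclideanSpace ℝ (Fin (d + 1)))).restrict (frontier (boxCell (d + 1))) =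
      Measure.sum fun p : Fin (d + 1) × Fin 2 =>
        (μH[(d : ℝ)].restrict (boxCell d)).map (faceMap p.1 (p.2 : ℕ)) := by
  rw [frontier_boxCell, Measure.restrict_iUnion_ae aedisjoint_boxFace
    fun p => (measurableSet_boxFace p).nullMeasurableSet]
  congr 1
  funext p
  have hiso := isometry_faceMap (d := d) p.1 (p.2 : ℕ)
  have hemb : MeasurableEmbedding (faceMap (d := d) p.1 (p.2 : ℕ)) :=
    hiso.isClosedEmbedding.measurableEmbedding
  ext A hA
  rw [hemb.map_apply, Measure.restrict_apply hA, Measure.restrict_apply (hemb.measurable hA),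
    ← hiso.hausdorffMeasure_image (Or.inl (Nat.cast_nonneg d)), Set.image_preimage_inter]
  rfl

lemma volume_boxCell (d : ℕ) : volume (boxCell d) = 1 := by
  have h1 : boxCell d = (WithLp.ofLp (p := 2) (V := Fin d → ℝ)) ⁻¹'
      (Set.pi Set.univ fun _ => Set.Icc 0 1) := by
    ext x; simp only [boxCell, Set.mem_preimage, Set.mem_pi, Set.mem_univ, true_imp_iff, Set.mem_ofPred_eq]
  rw [h1, (PiLp.volume_preserving_ofLp (Fin d)).measure_preimage_emb
      (MeasurableEquiv.toLp 2 (Fin d → ℝ)).symm.measurableEmbedding, volume_pi_pi]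
  simp

lemma integral_boxCell_prod (d : ℕ) (f : Fin d → ℝ → ℝ) :
    ∫ x in boxCell d, ∏ i, f i (x i) = ∏ i, ∫ t in (0 : ℝ)..1, f i t := by
  have h1 : boxCell d = (WithLp.ofLp (p := 2) (V := Fin d → ℝ)) ⁻¹'
      (Set.pi Set.univ fun _ => Set.Icc 0 1) := by
    ext x; simp only [boxCell, Set.mem_preimage, Set.mem_pi, Set.mem_univ, true_imp_iff, Set.mem_ofPred_eq]
  rw [h1, (PiLp.volume_preserving_ofLp (Fin d)).setIntegral_preimage_emb
      (MeasurableEquiv.toLp 2 (Fin d → ℝ)).symm.measurableEmbedding (fun z => ∏ i, f i (z i)),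
    volume_pi, Measure.restrict_pi_pi, integral_fintype_prod_eq_prod]
  refine Finset.prod_congr rfl fun i _ => ?_
  rw [intervalIntegral.integral_of_le zero_le_one, integral_Icc_eq_integral_Ioc]

lemma hausdorffMeasure_frontier_boxCell :
    ∃ c : NNReal, c ≠ 0 ∧
      (μH[(d : ℝ)] : Measure (EuclideanSpace ℝ (Fin (d + 1)))).restrict
        (frontier (boxCell (d + 1))) = c • Measure.sum fun p : Fin (d + 1) × Fin 2 =>
        (volume.restrict (boxCell d)).map (faceMap p.1 (p.2 : ℕ)) := by
  obtain ⟨c, hc0, hc⟩ := exists_hausdorffMeasure_eq_smul d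
  refine ⟨c, hc0, ?_⟩
  rw [restrict_frontier_boxCell, hc]
  ext A hA
  simp only [Measure.restrict_smul, Measure.map_smul, Measure.smul_apply, Measure.sum_apply _ hA]
  rw [tsum_fintype, tsum_fintype, Finset.smul_sum]

end

/-! ### Box averages in centred coordinates -/

section
variable {d : ℕ}

lemma exists_hausdorffMeasure_frontier_boxCell (d : ℕ) : ∃ c : NNReal, c ≠ 0 ∧
    μH[(d : ℝ)] (frontier (boxCell (d + 1))) = c * (2 * (d + 1)) ∧
    ∀ U : MvPolynomial (Fin (d + 1)) ℝ, ∫ x in frontier (boxCell (d + 1)), polyEval U x ∂μH[(d : ℝ)] =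
      c * ∑ p : Fin (d + 1) × Fin 2, ∫ y in boxCell d, polyEval U (faceMap p.1 (p.2 : ℕ) y) := by
  obtain ⟨c, hc0, hc⟩ := hausdorffMeasure_frontier_boxCell (d := d)
  have hemb : ∀ p : Fin (d + 1) × Fin 2, MeasurableEmbedding (faceMap (d := d) p.1 (p.2 : ℕ)) :=
    fun p => (isometry_faceMap p.1 _).isClosedEmbedding.measurableEmbedding
  refine ⟨c, hc0, ?_, fun U => ?_⟩
  · rw [← Measure.restrict_apply_univ, hc, Measure.smul_apply, Measure.sum_apply _ MeasurableSet.univ,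
      tsum_fintype]
    simp only [(hemb _).map_apply, Set.preimage_univ, Measure.restrict_apply_univ, volume_boxCell]
    rw [ENNReal.smul_def, smul_eq_mul]
    congr 1
    simp
    ring
  · rw [hc, integral_smul_nnreal_measure, Measure.sum_fintype, integral_finsetSum_measure]
    · rw [NNReal.smul_def, smul_eq_mul]
      congr 1
      exact Finset.sum_congr rfl fun p _ => (hemb p).integral_map _
    · intro p _
      rw [(hemb p).integrable_map_iff]
      refine ContinuousOn.integrableOn_compact (isCompact_boxCell d) ?_
      exact ((continuous_polyEval U).comp (isometry_faceMap _ _).continuous).continuousOn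

lemma hausdorffMeasure_frontier_boxCell_ne_top (d : ℕ) :
    μH[(d : ℝ)] (frontier (boxCell (d + 1))) ≠ ⊤ := by
  obtain ⟨c, -, h, -⟩ := exists_hausdorffMeasure_frontier_boxCell d
  rw [h]
  finiteness

lemma hausdorffMeasure_frontier_boxCell_ne_zero (d : ℕ) :
    μH[(d : ℝ)] (frontier (boxCell (d + 1))) ≠ 0 := by
  obtain ⟨c, h0, h, -⟩ := exists_hausdorffMeasure_frontier_boxCell d
  rw [h]
  simp [h0]

lemma isCompact_frontier {D : ℕ} {K : Set (EuclideanSpace ℝ (Fin D))}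
    (hK : IsCompact K) : IsCompact (frontier K) :=
  hK.of_isClosed_subset isClosed_frontier hK.isClosed.frontier_subset

/-- The factor `c` between Hausdorff and Lebesgue measure cancels in an average, so its value is
never needed. -/
lemma setAverage_frontier_boxCell (U : MvPolynomial (Fin (d + 1)) ℝ) :
    ⨍ x in frontier (boxCell (d + 1)), polyEval U x ∂μH[(d : ℝ)] =
      (2 * ((d : ℝ) + 1))⁻¹ *
        ∑ p : Fin (d + 1) × Fin 2, ∫ y in boxCell d, polyEval U (faceMap p.1 (p.2 : ℕ) y) := by
  obtain ⟨c, hc0, h, hU⟩ := exists_hausdorffMeasure_frontier_boxCell d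
  rw [setAverage_eq, hU U, measureReal_def, h]
  have : ((c : ENNReal) * (2 * ((d : ENNReal) + 1))).toReal = c * (2 * ((d : ℝ) + 1)) := by
    rw [ENNReal.toReal_mul, ENNReal.toReal_mul, ENNReal.toReal_add (by finiteness) (by finiteness)]
    simp
  have hc : (c : ℝ) ≠ 0 := by exact_mod_cast hc0
  rw [this, smul_eq_mul]
  field_simp

/-- The change of variables `x ↦ 2 x - 1`. -/
def center (D : ℕ) : MvPolynomial (Fin D) ℝ →ₐ[ℝ] MvPolynomial (Fin D) ℝ :=
  MvPolynomial.aeval fun i => MvPolynomial.C 2 * MvPolynomial.X i - MvPolynomial.C 1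

/-- The change of variables `x ↦ (x + 1) / 2`. -/
def uncenter (D : ℕ) : MvPolynomial (Fin D) ℝ →ₐ[ℝ] MvPolynomial (Fin D) ℝ :=
  MvPolynomial.aeval fun i => MvPolynomial.C (1 / 2) * MvPolynomial.X i + MvPolynomial.C (1 / 2)

lemma polyEval_center {D : ℕ} (U : MvPolynomial (Fin D) ℝ) (x : EuclideanSpace ℝ (Fin D)) :
    polyEval (center D U) x = polyEval U (WithLp.toLp 2 fun i => 2 * x i - 1) := by
  rw [polyEval, center, eval_aeval, polyEval]
  simp

lemma polyEval_uncenter {D : ℕ} (U : MvPolynomial (Fin D) ℝ) (x : EuclideanSpace ℝ (Fin D)) :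
    polyEval (uncenter D U) x = polyEval U (WithLp.toLp 2 fun i => 1 / 2 * x i + 1 / 2) := by
  rw [polyEval, uncenter, eval_aeval, polyEval]
  simp

lemma center_uncenter {D : ℕ} (U : MvPolynomial (Fin D) ℝ) : center D (uncenter D U) = U := by
  refine MvPolynomial.funext fun z => ?_
  have h1 := polyEval_center (uncenter D U) (WithLp.toLp 2 z)
  rw [polyEval_uncenter] at h1
  have h2 : (WithLp.toLp 2 fun i => 1 / 2 * (WithLp.toLp 2 fun i => 2 * z i - 1 :
      EuclideanSpace ℝ (Fin D)) i + 1 / 2 : EuclideanSpace ℝ (Fin D)) = WithLp.toLp 2 z := by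
    ext i; simp; ring
  exact h1.trans (congrArg (polyEval U) h2)

lemma totalDegree_affine_le {D : ℕ} (a b : ℝ) (i : Fin D) :
    (MvPolynomial.C a * MvPolynomial.X i + MvPolynomial.C b).totalDegree ≤ 1 := by
  refine (MvPolynomial.totalDegree_add _ _).trans (max_le ?_ (by simp))
  refine (MvPolynomial.totalDegree_mul _ _).trans ?_
  simp

lemma uncenter_mem {D k : ℕ} {U : MvPolynomial (Fin D) ℝ} (hU : U ∈ polySpace D k) :
    uncenter D U ∈ polySpace D k :=
  aeval_mem_polySpace (totalDegree_affine_le _ _) hU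

lemma center_mem {D k : ℕ} {U : MvPolynomial (Fin D) ℝ} (hU : U ∈ polySpace D k) :
    center D U ∈ polySpace D k :=
  aeval_mem_polySpace (fun i => by
    have := totalDegree_affine_le 2 (-1) i
    rwa [map_neg, ← sub_eq_add_neg] at this) hU

/-- The right side is the sum of `(2 s - 1) ^ a` over the endpoints `s = 0, 1`; this is the
divergence theorem in one coordinate. -/
lemma two_mul_integral_centered_pow (a : ℕ) :
    2 * ((a : ℝ) + 1) * ∫ t in (0 : ℝ)..1, (2 * t - 1) ^ a = 1 + (-1) ^ a := by
  rw [intervalIntegral.integral_comp_mul_sub (fun t => t ^ a) two_ne_zero, integral_pow]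
  have : (a : ℝ) + 1 ≠ 0 := by positivity
  rw [smul_eq_mul]
  field_simp
  norm_num
  ring

lemma polyEval_monomial {D : ℕ} (α : Fin D →₀ ℕ) (x : EuclideanSpace ℝ (Fin D)) :
    polyEval (MvPolynomial.monomial α 1) x = ∏ i, x i ^ α i := by
  rw [polyEval, MvPolynomial.eval_monomial, one_mul, Finsupp.prod_fintype]
  simp

/-- The boundary average over the unit box, as a functional of the centred polynomial. -/
def boxBoundaryFunctional (d : ℕ) : MvPolynomial (Fin (d + 1)) ℝ →ₗ[ℝ] ℝ :=
  averageFunctional (isCompact_frontier (isCompact_boxCell (d + 1)))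
    (hausdorffMeasure_frontier_boxCell_ne_top d) ∘ₗ (center (d + 1)).toLinearMap

/-- The cell average over the unit box, as a functional of the centred polynomial. -/
def boxCellFunctional (d : ℕ) : MvPolynomial (Fin (d + 1)) ℝ →ₗ[ℝ] ℝ :=
  averageFunctional (isCompact_boxCell (d + 1)) ((isCompact_boxCell (d + 1)).measure_ne_top (μ := volume)) ∘ₗ
    (center (d + 1)).toLinearMap

lemma boxCellFunctional_monomial (α : Fin (d + 1) →₀ ℕ) :
    boxCellFunctional d (MvPolynomial.monomial α 1) =
      ∏ i, ∫ t in (0 : ℝ)..1, (2 * t - 1) ^ α i := by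
  rw [← integral_boxCell_prod (d + 1) fun i t => (2 * t - 1) ^ α i, boxCellFunctional,
    LinearMap.comp_apply, averageFunctional_apply, setAverage_eq, measureReal_def, volume_boxCell]
  simp [polyEval_center, polyEval_monomial]

/-- The two faces normal to `i` together contribute `2 (α i + 1)` times the product of
one-dimensional integrals. Summing over `i` produces `2 (α.degree + d + 1)`. -/
lemma boxBoundaryFunctional_monomial (α : Fin (d + 1) →₀ ℕ) :
    (d + 1) * boxBoundaryFunctional d (MvPolynomial.monomial α 1) =
      ((α.degree : ℝ) + (d + 1)) * ∏ i, ∫ t in (0 : ℝ)..1, (2 * t - 1) ^ α i := by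
  have h1 : ∀ (i : Fin (d + 1)) (s : Fin 2),
      ∫ y in boxCell d, polyEval (center (d + 1) (MvPolynomial.monomial α 1))
        (faceMap i (s : ℕ) y) = (2 * ((s : ℕ) : ℝ) - 1) ^ α i *
          ∏ j, ∫ t in (0 : ℝ)..1, (2 * t - 1) ^ α (i.succAbove j) := by
    intro i s
    rw [← integral_boxCell_prod d fun j t => (2 * t - 1) ^ α (i.succAbove j), ← integral_const_mul]
    congr 1 with y
    rw [polyEval_center, polyEval_monomial, Fin.prod_univ_succAbove _ i]
    simp
  have h2 : ∀ i : Fin (d + 1), ∑ s : Fin 2,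
      ∫ y in boxCell d, polyEval (center (d + 1) (MvPolynomial.monomial α 1))
        (faceMap i (s : ℕ) y) = 2 * ((α i : ℝ) + 1) *
          ∏ i, ∫ t in (0 : ℝ)..1, (2 * t - 1) ^ α i := by
    intro i
    rw [Fin.prod_univ_succAbove _ i, ← mul_assoc, two_mul_integral_centered_pow, Fin.sum_univ_two,
      h1, h1]
    norm_num
    ring
  rw [boxBoundaryFunctional, LinearMap.comp_apply, averageFunctional_apply,
    AlgHom.toLinearMap_apply, setAverage_frontier_boxCell, Fintype.sum_prod_type]
  simp only [h2]
  rw [← Finset.sum_mul, ← Finset.mul_sum, Finset.sum_add_distrib, Finsupp.degree_eq_sum]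
  have : (d : ℝ) + 1 ≠ 0 := by positivity
  simp
  field_simp

lemma radialPair_box (d : ℕ) : RadialPair (boxBoundaryFunctional d) (boxCellFunctional d) where
  scale α := by rw [boxBoundaryFunctional_monomial, boxCellFunctional_monomial]
  odd α hα := by
    have h0 : ∏ i, ∫ t in (0 : ℝ)..1, (2 * t - 1) ^ α i = 0 := by
      obtain ⟨i, hi⟩ : ∃ i, Odd (α i) := by
        by_contra! h
        rw [Finsupp.degree_eq_sum, ← Nat.not_even_iff_odd] at hα
        exact hα (Finset.even_sum _ fun i _ => Nat.not_odd_iff_even.1 (h i))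
      refine Finset.prod_eq_zero (Finset.mem_univ i) ?_
      have := two_mul_integral_centered_pow (α i)
      rw [hi.neg_one_pow, add_neg_cancel] at this
      refine (mul_eq_zero.1 this).resolve_left ?_
      positivity
    have := boxBoundaryFunctional_monomial α
    rw [h0, mul_zero] at this
    refine (mul_eq_zero.1 this).resolve_left ?_
    positivity

end

/-! ### Uniqueness of uniformly distributed measures -/

section UniformlyDistributed
variable {X : Type*} [MetricSpace X] [CompactSpace X] [MeasurableSpace X] [BorelSpace X]

lemma integrable_ball_kernel {σ τ : Measure X} [IsFiniteMeasure σ] [IsFiniteMeasure τ]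
    {g : X × X → ℝ} (hg : Continuous g) (ε : ℝ) :
    Integrable ({p : X × X | dist p.1 p.2 < ε}.indicator g) (σ.prod τ) := by
  refine Integrable.indicator ?_ (isOpen_lt (by fun_prop) continuous_const).measurableSet
  exact hg.integrable_of_hasCompactSupport (HasCompactSupport.of_compactSpace g)

/-- Two finite measures on a compact metric space for which all balls of equal radius have equal
measure are proportional. -/
theorem integral_mul_eq_of_uniform {σ τ : Measure X} [IsFiniteMeasure σ] [IsFiniteMeasure τ]
    (hσ : ∀ x y r, σ (Metric.ball x r) = σ (Metric.ball y r))
    (hτ : ∀ x y r, τ (Metric.ball x r) = τ (Metric.ball y r)) {f : X → ℝ} (hf : Continuous f) :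
    τ.real Set.univ * ∫ x, f x ∂σ = σ.real Set.univ * ∫ x, f x ∂τ := by
  classical
  rcases isEmpty_or_nonempty X with hX | ⟨⟨x₀⟩⟩
  · rw [σ.eq_zero_of_isEmpty, τ.eq_zero_of_isEmpty]
  rcases eq_or_ne σ 0 with rfl | hσ0
  · simp
  refine eq_of_forall_dist_le fun η hη => ?_
  obtain ⟨δ, hδ, hδη⟩ : ∃ δ > 0, δ * (σ.real Set.univ * τ.real Set.univ) ≤ η := by
    refine ⟨η / (σ.real Set.univ * τ.real Set.univ + 1), by positivity, ?_⟩
    rw [div_mul_eq_mul_div, div_le_iff₀ (by positivity)]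
    nlinarith [show 0 ≤ σ.real Set.univ * τ.real Set.univ by positivity]
  obtain ⟨ε, hε, hfε⟩ := Metric.uniformContinuous_iff.1
    (CompactSpace.uniformContinuous_of_continuous hf) δ hδ
  set a := σ.real (Metric.ball x₀ ε) with ha
  set b := τ.real (Metric.ball x₀ ε) with hb
  have haσ : ∀ x, σ.real (Metric.ball x ε) = a := fun x => by
    rw [ha, measureReal_def, measureReal_def, hσ x x₀]
  have hbτ : ∀ x, τ.real (Metric.ball x ε) = b := fun x => by
    rw [hb, measureReal_def, measureReal_def, hτ x x₀]
  have ha0 : 0 < a := by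
    refine lt_of_le_of_ne measureReal_nonneg fun h0 => hσ0 ?_
    have hball : ∀ x, σ (Metric.ball x ε) = 0 := fun x =>
      (measureReal_eq_zero_iff).1 ((haσ x).trans h0.symm)
    rw [← Measure.measure_univ_eq_zero]
    exact isCompact_univ.measure_zero_of_nhdsWithin fun x _ =>
      ⟨Metric.ball x ε, mem_nhdsWithin_of_mem_nhds (Metric.ball_mem_nhds x hε), hball x⟩
  let s : Set (X × X) := {p | dist p.1 p.2 < ε}
  have hint1 : ∀ g : X → ℝ, Continuous g → Integrable (s.indicator fun p => g p.1) (σ.prod τ) :=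
    fun g hg => integrable_ball_kernel (hg.comp continuous_fst) ε
  have hint2 : ∀ g : X → ℝ, Continuous g → Integrable (s.indicator fun p => g p.2) (σ.prod τ) :=
    fun g hg => integrable_ball_kernel (hg.comp continuous_snd) ε
  -- By Fubini, integrating `g p.1` or `g p.2` over the pairs at distance below `ε` gives multiples
  -- of the two integrals, since balls of radius `ε` have constant measure. Taking `g = 1` compares
  -- `a` with `b`.
  have hI1 : ∀ g : X → ℝ, Continuous g →
      ∫ p, s.indicator (fun p => g p.1) p ∂(σ.prod τ) = b * ∫ x, g x ∂σ := by
    intro g hg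
    rw [integral_prod _ (hint1 g hg), ← integral_const_mul]
    congr 1 with x
    have : ∀ y, s.indicator (fun p => g p.1) (x, y) =
        (Metric.ball x ε).indicator (fun _ => g x) y := fun y => by
      simp only [Set.indicator, s, Set.mem_ofPred_eq, Metric.mem_ball, dist_comm x y]
    simp only [this]
    rw [integral_indicator_const _ Metric.isOpen_ball.measurableSet, hbτ, smul_eq_mul]
  have hI2 : ∀ g : X → ℝ, Continuous g →
      ∫ p, s.indicator (fun p => g p.2) p ∂(σ.prod τ) = a * ∫ x, g x ∂τ := by
    intro g hg
    rw [integral_prod_symm _ (hint2 g hg),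
      ← integral_const_mul]
    congr 1 with y
    have : ∀ x, s.indicator (fun p => g p.2) (x, y) =
        (Metric.ball y ε).indicator (fun _ => g y) x := fun x => by
      simp only [Set.indicator, s, Set.mem_ofPred_eq, Metric.mem_ball]
    simp only [this]
    rw [integral_indicator_const _ Metric.isOpen_ball.measurableSet, haσ, smul_eq_mul]
  have hab : b * σ.real Set.univ = a * τ.real Set.univ := by
    have h1 := hI1 (fun _ => 1) continuous_const
    have h2 := hI2 (fun _ => 1) continuous_const
    simp only [integral_const, smul_eq_mul, mul_one] at h1 h2
    rw [← h1, ← h2]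
  -- On pairs closer than `ε` the values of `f` differ by less than `δ`.
  have hdiff : |b * ∫ x, f x ∂σ - a * ∫ x, f x ∂τ| ≤ δ * (a * τ.real Set.univ) := by
    have h2 := hI2 (fun _ => δ) continuous_const
    rw [integral_const, smul_eq_mul, ← mul_assoc, mul_comm _ δ] at h2
    rw [← h2, ← hI1 f hf, ← hI2 f hf, ← integral_sub (hint1 f hf) (hint2 f hf), ← Real.norm_eq_abs]
    refine norm_integral_le_of_norm_le (integrable_ball_kernel continuous_const ε)
      (ae_of_all _ fun p => ?_)
    by_cases hp : p ∈ s
    · simp only [Set.indicator_of_mem hp, s]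
      exact (hfε hp).le
    · simp only [Set.indicator_of_notMem hp, s]
      simp
  rw [Real.dist_eq]
  have hkey : a * (τ.real Set.univ * ∫ x, f x ∂σ - σ.real Set.univ * ∫ x, f x ∂τ) =
      σ.real Set.univ * (b * ∫ x, f x ∂σ - a * ∫ x, f x ∂τ) := by
    linear_combination -(∫ x, f x ∂σ) * hab
  have h3 := congrArg abs hkey
  rw [abs_mul, abs_mul, abs_of_pos ha0, abs_of_nonneg (measureReal_nonneg (μ := σ))] at h3
  have h4 := mul_le_mul_of_nonneg_left hdiff (measureReal_nonneg (μ := σ) (s := Set.univ))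
  rw [← h3] at h4
  refine le_trans (le_of_mul_le_mul_left ?_ ha0) hδη
  linarith

end UniformlyDistributed

/-! ### Polar coordinates and homogeneous functions -/

section Polar
open Set Metric

/-- Polar coordinates for a function that is the product of a radial and an angular part. -/
lemma integral_norm_mul_sphere {E : Type*} [NormedAddCommGroup E] [NormedSpace ℝ E]
    [MeasurableSpace E] [BorelSpace E] [FiniteDimensional ℝ E] [Nontrivial E] (μ : Measure E)
    [μ.IsAddHaarMeasure] (g : ℝ → ℝ) (f h : E → ℝ)
    (hf : ∀ (r : ℝ) (y : E), 0 < r → ‖y‖ = 1 → f (r • y) = g r * h y) :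
    ∫ x, f x ∂μ = (∫ y : sphere (0 : E) 1, h y ∂μ.toSphere) *
      ∫ r in Ioi (0 : ℝ), r ^ (Module.finrank ℝ E - 1) * g r := by
  calc
    ∫ x, f x ∂μ = ∫ x : ({(0)}ᶜ : Set E), f x ∂(μ.comap (↑)) := by
      rw [integral_subtype_comap (measurableSet_singleton _).compl fun x ↦ f x,
        restrict_compl_singleton]
    _ = ∫ p : sphere (0 : E) 1 × Ioi (0 : ℝ), h p.1 * g p.2
          ∂μ.toSphere.prod (.volumeIoiPow (Module.finrank ℝ E - 1)) := by
      rw [← μ.measurePreserving_homeomorphUnitSphereProd.integral_comp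
        (Homeomorph.measurableEmbedding _)
        (fun p : sphere (0 : E) 1 × Ioi (0 : ℝ) => h p.1 * g p.2)]
      congr 1 with x
      have hx := hf ((homeomorphUnitSphereProd E x).2 : ℝ) ((homeomorphUnitSphereProd E x).1 : E)
        (homeomorphUnitSphereProd E x).2.2 (by simpa using (homeomorphUnitSphereProd E x).1.2)
      rw [mul_comm, ← hx]
      congr 1
      have := congrArg Subtype.val ((homeomorphUnitSphereProd E).symm_apply_apply x)
      rw [← this]
      rfl
    _ = (∫ y : sphere (0 : E) 1, h y ∂μ.toSphere) *
          ∫ r : Ioi (0 : ℝ), g r ∂.volumeIoiPow (Module.finrank ℝ E - 1) :=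
      integral_prod_mul (fun y : sphere (0 : E) 1 => h y) (fun r : Ioi (0 : ℝ) => g r)
    _ = _ := by
      simp only [Measure.volumeIoiPow, ENNReal.ofReal]
      rw [integral_withDensity_eq_integral_smul,
        integral_subtype_comap measurableSet_Ioi
          fun a ↦ Real.toNNReal (a ^ (Module.finrank ℝ E - 1)) • g a,
        setIntegral_congr_fun measurableSet_Ioi fun x hx ↦ ?_]
      · rw [NNReal.smul_def, Real.coe_toNNReal _ (pow_nonneg hx.out.le _), smul_eq_mul]
      · exact (measurable_subtype_coe.pow_const _).real_toNNReal

/-- The integral over the unit ball of a homogeneous function. -/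
lemma integral_closedBall_of_homogeneous {E : Type*} [NormedAddCommGroup E] [NormedSpace ℝ E]
    [MeasurableSpace E] [BorelSpace E] [FiniteDimensional ℝ E] [Nontrivial E] (μ : Measure E)
    [μ.IsAddHaarMeasure] (f : E → ℝ) (j : ℕ) (hf : ∀ (r : ℝ) (y : E), f (r • y) = r ^ j * f y) :
    ((j : ℝ) + Module.finrank ℝ E) * ∫ x in closedBall (0 : E) 1, f x ∂μ =
      ∫ y : sphere (0 : E) 1, f y ∂μ.toSphere := by
  have hdim : 0 < Module.finrank ℝ E := Module.finrank_pos
  have h0 : (0 : ℝ) < (j : ℝ) + Module.finrank ℝ E := by positivity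
  have hI : ∫ r in Ioi (0 : ℝ), r ^ (Module.finrank ℝ E - 1) *
      (Iic (1 : ℝ)).indicator (fun r => r ^ j) r = 1 / ((j : ℝ) + Module.finrank ℝ E) := by
    have h1 : ∀ r : ℝ, r ^ (Module.finrank ℝ E - 1) * (Iic (1 : ℝ)).indicator (fun r => r ^ j) r =
        (Iic (1 : ℝ)).indicator (fun r => r ^ (j + (Module.finrank ℝ E - 1))) r := fun r => by
      by_cases hr : r ∈ Iic (1 : ℝ)
      · rw [indicator_of_mem hr, indicator_of_mem hr, pow_add, mul_comm]
      · rw [indicator_of_notMem hr, indicator_of_notMem hr, mul_zero]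
    simp only [h1]
    rw [setIntegral_indicator measurableSet_Iic, Ioi_inter_Iic,
      ← intervalIntegral.integral_of_le zero_le_one, integral_pow]
    rw [Nat.cast_add, Nat.cast_pred hdim,
      show (j : ℝ) + ((Module.finrank ℝ E : ℝ) - 1) + 1 = j + Module.finrank ℝ E by ring]
    simp
  rw [← integral_indicator isClosed_closedBall.measurableSet, integral_norm_mul_sphere μ
    ((Iic (1 : ℝ)).indicator fun r => r ^ j) _ f, hI]
  · field_simp
  · intro r y hr hy
    have hn : ‖r • y‖ = r := by rw [norm_smul, hy, mul_one, Real.norm_of_nonneg hr.le]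
    by_cases hr1 : r ∈ Iic (1 : ℝ)
    · rw [indicator_of_mem hr1, indicator_of_mem (by rwa [mem_closedBall_zero_iff, hn]), hf]
    · rw [indicator_of_notMem hr1, indicator_of_notMem (by rwa [mem_closedBall_zero_iff, hn]),
        zero_mul]

end Polar

/-! ### Hausdorff measure on the unit sphere -/

section
open Metric
open scoped Pointwise
variable {d : ℕ}

/-- Outside the open unit ball the radial projection is 2-Lipschitz. It will map the cube surface
onto the sphere. -/
lemma norm_normalize_sub_le {E : Type*} [NormedAddCommGroup E] [NormedSpace ℝ E] {x y : E}
    (hx : 1 ≤ ‖x‖) (hy : 1 ≤ ‖y‖) : ‖‖x‖⁻¹ • x - ‖y‖⁻¹ • y‖ ≤ 2 * ‖x - y‖ := by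
  have hx0 : 0 < ‖x‖ := one_pos.trans_le hx
  have hy0 : 0 < ‖y‖ := one_pos.trans_le hy
  have h1 : ‖x‖⁻¹ • x - ‖y‖⁻¹ • y = ‖x‖⁻¹ • (x - y) + (‖x‖⁻¹ * ((‖y‖ - ‖x‖) * ‖y‖⁻¹)) • y := by
    have : ‖x‖⁻¹ * ((‖y‖ - ‖x‖) * ‖y‖⁻¹) = ‖x‖⁻¹ - ‖y‖⁻¹ := by field_simp
    rw [this, smul_sub, sub_smul]
    abel
  have h2 : ‖x‖⁻¹ ≤ 1 := inv_le_one_of_one_le₀ hx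
  have h3 : |‖y‖ - ‖x‖| ≤ ‖x - y‖ := by
    rw [abs_sub_comm]; exact abs_norm_sub_norm_le x y
  calc ‖‖x‖⁻¹ • x - ‖y‖⁻¹ • y‖ ≤ ‖x‖⁻¹ * ‖x - y‖ + ‖x‖⁻¹ * |‖y‖ - ‖x‖| := by
        rw [h1]
        refine (norm_add_le _ _).trans (le_of_eq ?_)
        rw [norm_smul, norm_smul, norm_inv, norm_norm, norm_mul, norm_mul, norm_inv, norm_norm,
          norm_inv, norm_norm, Real.norm_eq_abs]
        field_simp
    _ ≤ 1 * ‖x - y‖ + 1 * ‖x - y‖ := by gcongr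
    _ = 2 * ‖x - y‖ := by ring

/-- The affine map sending the unit box to `[-1, 1] ^ D`. -/
def centerMap (D : ℕ) (x : EuclideanSpace ℝ (Fin D)) : EuclideanSpace ℝ (Fin D) :=
  WithLp.toLp 2 fun i => 2 * x i - 1

lemma centerMap_sub {D : ℕ} (x y : EuclideanSpace ℝ (Fin D)) :
    centerMap D x - centerMap D y = (2 : ℝ) • (x - y) := by
  ext i; simp [centerMap]; ring

lemma one_le_norm_centerMap {D : ℕ} {x : EuclideanSpace ℝ (Fin D)}
    (hx : x ∈ frontier (boxCell D)) : 1 ≤ ‖centerMap D x‖ := by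
  obtain ⟨-, i, hi⟩ := mem_frontier_boxCell.1 hx
  refine le_trans ?_ (PiLp.norm_apply_le (centerMap D x) i)
  rcases hi with hi | hi <;> simp [centerMap, hi]
  norm_num

/-- Dividing `y` by its largest absolute coordinate moves it to the surface of `[-1, 1] ^ D` along
its ray. -/
lemma sphere_subset_image_frontier_boxCell (D : ℕ) :
    sphere (0 : EuclideanSpace ℝ (Fin D)) 1 ⊆
      (fun x => ‖centerMap D x‖⁻¹ • centerMap D x) '' frontier (boxCell D) := by
  intro y hy
  rw [mem_sphere_zero_iff_norm] at hy
  have hne : Nonempty (Fin D) := by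
    by_contra hemp
    rw [not_nonempty_iff] at hemp
    rw [Subsingleton.elim y 0, norm_zero] at hy
    exact zero_ne_one hy
  obtain ⟨i, hi⟩ := Finite.exists_max fun i => |y i|
  have hpos : 0 < |y i| := by
    refine lt_of_le_of_ne (abs_nonneg _) fun h0 => ?_
    have : y = 0 := by
      ext j
      have := hi j
      rw [← h0] at this
      simpa using abs_nonpos_iff.1 this
    rw [this, norm_zero] at hy
    exact zero_ne_one hy
  set x : EuclideanSpace ℝ (Fin D) := WithLp.toLp 2 fun j => (y j / |y i| + 1) / 2 with hx
  have hcx : centerMap D x = |y i|⁻¹ • y := by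
    ext j; simp [centerMap, x]; ring
  have hle : ∀ j, -1 ≤ y j / |y i| ∧ y j / |y i| ≤ 1 := fun j => by
    rw [← abs_le, abs_div, abs_abs, div_le_one hpos]
    exact hi j
  refine ⟨x, mem_frontier_boxCell.2 ⟨fun j => ?_, i, ?_⟩, ?_⟩
  · have := hle j
    simp only [x, Set.mem_Icc]
    constructor <;> linarith
  · simp only [x]
    rcases abs_choice (y i) with h | h
    · right; rw [h, div_self (by rw [← h]; exact hpos.ne')]; norm_num
    · left
      have h0 : y i ≠ 0 := fun h0 => by rw [h0, abs_zero] at hpos; exact hpos.false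
      rw [h, div_neg, div_self h0]; norm_num
  · simp only [hcx, norm_smul, hy, mul_one, norm_inv, Real.norm_eq_abs, abs_abs, inv_inv, smul_smul]
    rw [mul_inv_cancel₀ hpos.ne', one_smul]

/-- The sphere is covered by a Lipschitz image of the box boundary; the constant 4 is 2 for the
normalisation times 2 for `centerMap`. -/
lemma hausdorffMeasure_sphere_ne_top (d : ℕ) :
    μH[(d : ℝ)] (sphere (0 : EuclideanSpace ℝ (Fin (d + 1))) 1) ≠ ⊤ := by
  have hlip : LipschitzOnWith 4 (fun x => ‖centerMap (d + 1) x‖⁻¹ • centerMap (d + 1) x)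
      (frontier (boxCell (d + 1))) := by
    refine LipschitzOnWith.of_dist_le_mul fun x hx y hy => ?_
    rw [dist_eq_norm, dist_eq_norm]
    refine (norm_normalize_sub_le (one_le_norm_centerMap hx) (one_le_norm_centerMap hy)).trans ?_
    rw [centerMap_sub, norm_smul]
    norm_num
    linarith
  refine ne_top_of_le_ne_top ?_ ((measure_mono (sphere_subset_image_frontier_boxCell (d + 1))).trans
    (hlip.hausdorffMeasure_image_le (Nat.cast_nonneg d)))
  exact ENNReal.mul_ne_top (by simp) (hausdorffMeasure_frontier_boxCell_ne_top d)

/-- Forgetting one coordinate is 1-Lipschitz and maps the sphere onto a set containing the open unit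
ball of `ℝ ^ d`. -/
lemma hausdorffMeasure_sphere_ne_zero (d : ℕ) :
    μH[(d : ℝ)] (sphere (0 : EuclideanSpace ℝ (Fin (d + 1))) 1) ≠ 0 := by
  let f : EuclideanSpace ℝ (Fin (d + 1)) → EuclideanSpace ℝ (Fin d) := fun x =>
    WithLp.toLp 2 fun j => x (Fin.succAbove 0 j)
  have hlip : LipschitzWith 1 f := by
    refine LipschitzWith.of_dist_le_mul fun x y => ?_
    rw [NNReal.coe_one, one_mul, EuclideanSpace.dist_eq, EuclideanSpace.dist_eq,
      Fin.sum_univ_succAbove _ 0]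
    exact Real.sqrt_le_sqrt (le_add_of_nonneg_left (by positivity))
  have hsub : ball (0 : EuclideanSpace ℝ (Fin d)) 1 ⊆
      f '' sphere (0 : EuclideanSpace ℝ (Fin (d + 1))) 1 := by
    intro y hy
    rw [mem_ball_zero_iff] at hy
    have hsq : ‖y‖ ^ 2 ≤ 1 := pow_le_one₀ (norm_nonneg y) hy.le
    refine ⟨faceMap 0 √(1 - ‖y‖ ^ 2) y, ?_, ?_⟩
    · rw [mem_sphere_zero_iff_norm, EuclideanSpace.norm_eq, Fin.sum_univ_succAbove _ 0,
        faceMap_same]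
      simp only [faceMap_succAbove]
      rw [Real.norm_eq_abs, sq_abs, Real.sq_sqrt (by linarith), ← EuclideanSpace.norm_sq_eq]
      simp
    · ext j; exact faceMap_succAbove 0 √(1 - ‖y‖ ^ 2) y j
  intro h0
  have h1 := (measure_mono hsub).trans (hlip.hausdorffMeasure_image_le (Nat.cast_nonneg d)
    (sphere (0 : EuclideanSpace ℝ (Fin (d + 1))) 1))
  rw [h0, mul_zero] at h1
  obtain ⟨c, hc0, hc⟩ := exists_hausdorffMeasure_eq_smul d
  rw [hc, Measure.smul_apply, nonpos_iff_eq_zero, ENNReal.smul_def, smul_eq_mul, mul_eq_zero] at h1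
  rcases h1 with h1 | h1
  · exact hc0 (by exact_mod_cast h1)
  · exact (isOpen_ball.measure_pos volume ⟨0, mem_ball_self one_pos⟩).ne' h1

section Sphere
variable {E : Type*} [NormedAddCommGroup E] [InnerProductSpace ℝ E]

lemma exists_linearIsometryEquiv_apply_eq [FiniteDimensional ℝ E] {x y : E} (h : ‖x‖ = ‖y‖) :
    ∃ e : E ≃ₗᵢ[ℝ] E, e x = y :=
  ⟨_, Submodule.reflection_sub h⟩

/-- The isometry of the unit sphere induced by a linear isometry. -/
def sphereIsometry (e : E ≃ₗᵢ[ℝ] E) : sphere (0 : E) 1 ≃ᵢ sphere (0 : E) 1 where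
  toFun x := ⟨e x, by simp⟩
  invFun x := ⟨e.symm x, by simp⟩
  left_inv x := by simp
  right_inv x := by simp
  isometry_toFun := Isometry.of_dist_eq fun x y => by
    rw [Subtype.dist_eq, Subtype.dist_eq]; exact e.isometry.dist_eq _ _

@[simp] lemma coe_sphereIsometry (e : E ≃ₗᵢ[ℝ] E) (x : sphere (0 : E) 1) :
    (sphereIsometry e x : E) = e x := rfl

lemma exists_sphereIsometry_apply_eq [FiniteDimensional ℝ E] (x y : sphere (0 : E) 1) :
    ∃ e : E ≃ₗᵢ[ℝ] E, sphereIsometry e x = y := by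
  obtain ⟨e, he⟩ := exists_linearIsometryEquiv_apply_eq (E := E) (x := x) (y := y)
    (by rw [norm_eq_of_mem_sphere, norm_eq_of_mem_sphere])
  exact ⟨e, Subtype.ext he⟩

lemma hausdorffMeasure_sphere_ball [FiniteDimensional ℝ E] [MeasurableSpace E] [BorelSpace E] (s : ℝ)
    (x y : sphere (0 : E) 1) (r : ℝ) : μH[s] (ball x r) = μH[s] (ball y r) := by
  obtain ⟨e, rfl⟩ := exists_sphereIsometry_apply_eq x y
  rw [← (sphereIsometry e).image_ball, IsometryEquiv.hausdorffMeasure_image]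

/-- `toSphere` is defined through the volume of the cone over a set, and linear isometries commute
with cones and preserve volume. -/
lemma toSphere_ball [FiniteDimensional ℝ E] [MeasurableSpace E] [BorelSpace E]
    (x y : sphere (0 : E) 1) (r : ℝ) :
    (volume : Measure E).toSphere (ball x r) = (volume : Measure E).toSphere (ball y r) := by
  obtain ⟨e, rfl⟩ := exists_sphereIsometry_apply_eq x y
  rw [toSphere_apply' _ isOpen_ball.measurableSet, toSphere_apply' _ isOpen_ball.measurableSet,
    ← (sphereIsometry e).image_ball]
  have himage : Set.Ioo (0 : ℝ) 1 • (((↑) : sphere (0 : E) 1 → E) '' (sphereIsometry e '' ball x r)) =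
      e '' (Set.Ioo (0 : ℝ) 1 • (((↑) : sphere (0 : E) 1 → E) '' ball x r)) := by
    ext z
    simp only [Set.mem_smul, Set.mem_image]
    constructor
    · rintro ⟨t, ht, _, ⟨_, ⟨w, hw, rfl⟩, rfl⟩, rfl⟩
      exact ⟨t • (w : E), ⟨t, ht, w, ⟨w, hw, rfl⟩, rfl⟩, by simp⟩
    · rintro ⟨_, ⟨t, ht, _, ⟨w, hw, rfl⟩, rfl⟩, rfl⟩
      exact ⟨t, ht, e w, ⟨sphereIsometry e w, ⟨w, hw, rfl⟩, rfl⟩, by simp⟩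
  rw [himage, ← LinearIsometryEquiv.coe_toMeasurableEquiv, MeasurableEquiv.image_eq_preimage_symm,
    MeasurePreserving.measure_preimage_equiv]
  exact e.symm.measurePreserving

end Sphere

/-- Both measures give equal mass to balls of equal radius, because reflections act transitively on
the sphere; hence they are proportional. This connects Hausdorff measure to polar coordinates. -/
lemma setAverage_sphere_eq (U : MvPolynomial (Fin (d + 1)) ℝ) :
    ⨍ x in sphere (0 : EuclideanSpace ℝ (Fin (d + 1))) 1, polyEval U x ∂μH[(d : ℝ)] =
      ((volume : Measure (EuclideanSpace ℝ (Fin (d + 1)))).toSphere.real Set.univ)⁻¹ *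
        ∫ x : sphere (0 : EuclideanSpace ℝ (Fin (d + 1))) 1, polyEval U x ∂(volume.toSphere) := by
  set S := sphere (0 : EuclideanSpace ℝ (Fin (d + 1))) 1 with hS
  have hmap : Measure.map ((↑) : S → EuclideanSpace ℝ (Fin (d + 1))) μH[(d : ℝ)] =
      μH[(d : ℝ)].restrict S := by
    rw [isometry_subtype_coe.map_hausdorffMeasure (Or.inl (Nat.cast_nonneg d)), Subtype.range_coe]
  have hemb : MeasurableEmbedding ((↑) : S → EuclideanSpace ℝ (Fin (d + 1))) :=
    MeasurableEmbedding.subtype_coe isClosed_sphere.measurableSet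
  have huniv : μH[(d : ℝ)] (Set.univ : Set S) = μH[(d : ℝ)] S := by
    rw [← Measure.restrict_apply_univ S, ← hmap, hemb.map_apply, Set.preimage_univ]
  have : IsFiniteMeasure (μH[(d : ℝ)] : Measure S) :=
    ⟨by rw [huniv]; exact (hausdorffMeasure_sphere_ne_top d).lt_top⟩
  have key := integral_mul_eq_of_uniform (hausdorffMeasure_sphere_ball (d : ℝ)) toSphere_ball
    (f := fun x : S => polyEval U x) ((continuous_polyEval U).comp continuous_subtype_val)
  rw [setAverage_eq, ← hmap, hemb.integral_map, measureReal_def, ← huniv, ← measureReal_def,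
    smul_eq_mul]
  have h1 : (μH[(d : ℝ)] : Measure S).real Set.univ ≠ 0 := by
    rw [measureReal_def, huniv]
    exact ENNReal.toReal_ne_zero.2
      ⟨hausdorffMeasure_sphere_ne_zero d, hausdorffMeasure_sphere_ne_top d⟩
  have h2 : (volume : Measure (EuclideanSpace ℝ (Fin (d + 1)))).toSphere.real Set.univ ≠ 0 := by
    rw [measureReal_ne_zero_iff, Ne, Measure.measure_univ_eq_zero]
    exact toSphere_ne_zero _
  field_simp
  linarith

lemma frontier_ballCell : frontier (ballCell (d + 1)) = sphere 0 1 :=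
  frontier_closedBall 0 one_ne_zero

lemma isCompact_ballCell (D : ℕ) : IsCompact (ballCell D) := isCompact_closedBall 0 1

/-- The boundary average over the unit ball. -/
def ballBoundaryFunctional (d : ℕ) : MvPolynomial (Fin (d + 1)) ℝ →ₗ[ℝ] ℝ :=
  averageFunctional (isCompact_sphere (0 : EuclideanSpace ℝ (Fin (d + 1))) 1)
    (hausdorffMeasure_sphere_ne_top d)

/-- The cell average over the unit ball. -/
def ballCellFunctional (d : ℕ) : MvPolynomial (Fin (d + 1)) ℝ →ₗ[ℝ] ℝ :=
  averageFunctional (isCompact_ballCell (d + 1)) ((isCompact_ballCell (d + 1)).measure_ne_top (μ := volume))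

lemma polyEval_monomial_smul {D : ℕ} (α : Fin D →₀ ℕ) (r : ℝ) (x : EuclideanSpace ℝ (Fin D)) :
    polyEval (MvPolynomial.monomial α 1) (r • x) =
      r ^ α.degree * polyEval (MvPolynomial.monomial α 1) x := by
  rw [← polyEval_dilate, dilate_monomial, polyEval, MvPolynomial.smul_eval, polyEval]

/-- The scaling relation is polar integration of a homogeneous function; the vanishing of odd
monomials comes from the antipodal map. -/
lemma radialPair_ball (d : ℕ) : RadialPair (ballBoundaryFunctional d) (ballCellFunctional d) where
  scale α := by
    have h := integral_closedBall_of_homogeneous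
      (volume : Measure (EuclideanSpace ℝ (Fin (d + 1)))) _ α.degree
      (fun r y => polyEval_monomial_smul α r y)
    have hv : (volume : Measure (EuclideanSpace ℝ (Fin (d + 1)))).real (closedBall 0 1) =
        (volume : Measure (EuclideanSpace ℝ (Fin (d + 1)))).real (ball 0 1) := by
      rw [measureReal_def, measureReal_def, addHaar_closedBall_eq_addHaar_ball]
    have hv0 : (volume : Measure (EuclideanSpace ℝ (Fin (d + 1)))).real (ball 0 1) ≠ 0 := by
      rw [measureReal_ne_zero_iff]
      exact (isOpen_ball.measure_pos volume ⟨0, mem_ball_self one_pos⟩).ne'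
    rw [ballCellFunctional, ballBoundaryFunctional, averageFunctional_apply,
      averageFunctional_apply, setAverage_sphere_eq, setAverage_eq, ballCell, ← h,
      toSphere_real_apply_univ, hv, smul_eq_mul, finrank_euclideanSpace_fin]
    push_cast
    field_simp
  odd α hα := by
    have h1 : ∀ x : EuclideanSpace ℝ (Fin (d + 1)), polyEval (MvPolynomial.monomial α 1) (-x) =
        - polyEval (MvPolynomial.monomial α 1) x := fun x => by
      rw [← neg_one_smul ℝ x, polyEval_monomial_smul, hα.neg_one_pow, neg_one_mul]
    rw [ballBoundaryFunctional, averageFunctional_apply, setAverage_eq]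
    have h2 : ∫ x in sphere (0 : EuclideanSpace ℝ (Fin (d + 1))) 1,
        polyEval (MvPolynomial.monomial α 1) x ∂μH[(d : ℝ)] =
        ∫ x in sphere (0 : EuclideanSpace ℝ (Fin (d + 1))) 1,
        polyEval (MvPolynomial.monomial α 1) (-x) ∂μH[(d : ℝ)] := by
      have hmp := (LinearIsometryEquiv.neg ℝ
        (E := EuclideanSpace ℝ (Fin (d + 1)))).toIsometryEquiv.measurePreserving_hausdorffMeasure (d : ℝ)
      have := hmp.setIntegral_preimage_emb
        (LinearIsometryEquiv.neg ℝ (E := EuclideanSpace ℝ (Fin (d + 1)))).toHomeomorph.measurableEmbedding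
        (polyEval (MvPolynomial.monomial α 1)) (sphere 0 1)
      rw [← this]
      congr 2
      ext x
      simp
    simp only [h1, integral_neg] at h2
    rw [show ∫ x in sphere (0 : EuclideanSpace ℝ (Fin (d + 1))) 1,
      polyEval (MvPolynomial.monomial α 1) x ∂μH[(d : ℝ)] = 0 by linarith, smul_zero]

end

/-! ### Bounds for both cells and extremal polynomials -/

section
variable {d : ℕ}

lemma boundaryAverage_ballCell (U : MvPolynomial (Fin (d + 1)) ℝ) :
    boundaryAverage (ballCell (d + 1)) U = ballBoundaryFunctional d U := by
  rw [boundaryAverage, frontier_ballCell, Nat.cast_succ, add_sub_cancel_right]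
  rfl

lemma cellAverage_ballCell (U : MvPolynomial (Fin (d + 1)) ℝ) :
    cellAverage (ballCell (d + 1)) U = ballCellFunctional d U := rfl

lemma boundaryAverage_boxCell (U : MvPolynomial (Fin (d + 1)) ℝ) :
    boundaryAverage (boxCell (d + 1)) (center (d + 1) U) = boxBoundaryFunctional d U := by
  rw [boundaryAverage, Nat.cast_succ, add_sub_cancel_right]
  rfl

lemma cellAverage_boxCell (U : MvPolynomial (Fin (d + 1)) ℝ) :
    cellAverage (boxCell (d + 1)) (center (d + 1) U) = boxCellFunctional d U := rfl

lemma isClosed_boxCell (D : ℕ) : IsClosed (boxCell D) := (isCompact_boxCell D).isClosed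

/-- The cube `[-1, 1] ^ D`. -/
def centeredBox (D : ℕ) : Set (EuclideanSpace ℝ (Fin D)) := {x | ∀ i, x i ∈ Set.Icc (-1 : ℝ) 1}

lemma polyEval_nonneg_iff_centeredBox {D : ℕ} {U : MvPolynomial (Fin D) ℝ} :
    (∀ x ∈ boxCell D, 0 ≤ polyEval (center D U) x) ↔ ∀ x ∈ centeredBox D, 0 ≤ polyEval U x := by
  simp only [polyEval_center]
  refine ⟨fun h x hx => ?_, fun h x hx => h _ fun i => ?_⟩
  · have := h (WithLp.toLp 2 fun i => (x i + 1) / 2) fun i => by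
      have := hx i
      simp only [Set.mem_Icc] at this ⊢
      constructor <;> linarith
    convert this using 2
    ext i
    simp only
    ring
  · have := hx i
    simp only [Set.mem_Icc] at this ⊢
    constructor <;> linarith

lemma ballBoundaryFunctional_dilate_nonneg {U : MvPolynomial (Fin (d + 1)) ℝ}
    (hU : ∀ x ∈ ballCell (d + 1), 0 ≤ polyEval U x) {r : ℝ} (hr : r ∈ Set.Icc (0 : ℝ) 1) :
    0 ≤ ballBoundaryFunctional d (dilate r U) := by
  refine averageFunctional_nonneg _ _ fun x hx => ?_
  rw [polyEval_dilate]
  refine hU _ ?_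
  rw [mem_sphere_zero_iff_norm] at hx
  rw [ballCell, mem_closedBall_zero_iff, norm_smul, hx, mul_one, Real.norm_of_nonneg hr.1]
  exact hr.2

lemma polyEval_center_dilate_nonneg {D : ℕ} {U : MvPolynomial (Fin D) ℝ}
    (hU : ∀ x ∈ centeredBox D, 0 ≤ polyEval U x) {r : ℝ} (hr : r ∈ Set.Icc (0 : ℝ) 1) :
    ∀ x ∈ boxCell D, 0 ≤ polyEval (center D (dilate r U)) x := by
  refine polyEval_nonneg_iff_centeredBox.2 fun x hx => ?_
  rw [polyEval_dilate]
  refine hU _ fun i => ?_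
  have h1 := hx i
  rw [PiLp.smul_apply, smul_eq_mul]
  rw [Set.mem_Icc, ← abs_le] at h1 ⊢
  rw [abs_mul, abs_of_nonneg hr.1]
  exact mul_le_one₀ hr.2 (abs_nonneg _) h1

lemma boxBoundaryFunctional_dilate_nonneg {U : MvPolynomial (Fin (d + 1)) ℝ}
    (hU : ∀ x ∈ centeredBox (d + 1), 0 ≤ polyEval U x) {r : ℝ} (hr : r ∈ Set.Icc (0 : ℝ) 1) :
    0 ≤ boxBoundaryFunctional d (dilate r U) :=
  averageFunctional_nonneg (isCompact_frontier (isCompact_boxCell (d + 1)))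
    (hausdorffMeasure_frontier_boxCell_ne_top d) fun x hx => polyEval_center_dilate_nonneg hU hr x
    ((isClosed_boxCell (d + 1)).frontier_subset hx)

lemma polySpace_mono {D k l : ℕ} (h : k ≤ l) : polySpace D k ≤ polySpace D l := fun U hU => by
  rw [MvPolynomial.mem_restrictTotalDegree] at hU ⊢
  exact hU.trans h

theorem optimalWeight_ballCell_le {n k : ℕ} (hk : k ≤ 2 * n + 1) :
    optimalWeight (ballCell (d + 1)) (polySpace (d + 1) k) ≤ (ballWeight d n : EReal) := by
  obtain ⟨_, _, _, h⟩ := (radialPair_ball d).exists_le n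
  refine iSup₂_le fun U hU => EReal.coe_le_coe ?_
  rw [boundaryCrowding, boundaryAverage_ballCell, div_le_iff₀ hU.2.2]
  exact (h U (polySpace_mono hk hU.1) fun r hr => ballBoundaryFunctional_dilate_nonneg hU.2.1 hr).1

lemma optimalWeight_boxCell_le_of_forall {k : ℕ} {M : ℝ}
    (h : ∀ V ∈ polySpace (d + 1) k, (∀ x ∈ centeredBox (d + 1), 0 ≤ polyEval V x) →
      0 < boxCellFunctional d V → boxBoundaryFunctional d V ≤ M * boxCellFunctional d V) :
    optimalWeight (boxCell (d + 1)) (polySpace (d + 1) k) ≤ (M : EReal) := by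
  refine iSup₂_le fun U hU => EReal.coe_le_coe ?_
  obtain ⟨hk, hpos, hC⟩ := hU
  rw [boundaryCrowding, div_le_iff₀ hC]
  rw [← center_uncenter U] at hpos hC ⊢
  rw [boundaryAverage_boxCell, cellAverage_boxCell]
  exact h _ (uncenter_mem hk) (polyEval_nonneg_iff_centeredBox.1 hpos) hC

theorem optimalWeight_boxCell_le {n k : ℕ} (hk : k ≤ 2 * n + 1) :
    optimalWeight (boxCell (d + 1)) (polySpace (d + 1) k) ≤ (ballWeight d n : EReal) := by
  obtain ⟨_, _, _, h⟩ := (radialPair_box d).exists_le n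
  exact optimalWeight_boxCell_le_of_forall fun V hV hpos _ =>
    (h V (polySpace_mono hk hV) fun r hr => boxBoundaryFunctional_dilate_nonneg hpos hr).1

lemma le_optimalWeight_boxCell {k : ℕ} {M : ℝ} {V : MvPolynomial (Fin (d + 1)) ℝ}
    (hV : V ∈ polySpace (d + 1) k) (hpos : ∀ x ∈ centeredBox (d + 1), 0 ≤ polyEval V x)
    (hC : 0 < boxCellFunctional d V) (hM : boxBoundaryFunctional d V = M * boxCellFunctional d V) :
    (M : EReal) ≤ optimalWeight (boxCell (d + 1)) (polySpace (d + 1) k) := by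
  refine le_iSup₂_of_le (center (d + 1) V)
    ⟨center_mem hV, polyEval_nonneg_iff_centeredBox.2 hpos, hC⟩ (EReal.coe_le_coe (le_of_eq ?_))
  rw [boundaryCrowding, boundaryAverage_boxCell, cellAverage_boxCell, hM, mul_div_cancel_right₀ _ hC.ne']

/-- The radial polynomial `x ↦ p (‖x‖ ^ 2)`. -/
def radialPoly (D : ℕ) (p : Polynomial ℝ) : MvPolynomial (Fin D) ℝ :=
  Polynomial.aeval (∑ i, MvPolynomial.X i ^ 2) p

lemma polyEval_radialPoly {D : ℕ} (p : Polynomial ℝ) (x : EuclideanSpace ℝ (Fin D)) :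
    polyEval (radialPoly D p) x = p.eval (‖x‖ ^ 2) := by
  have : (MvPolynomial.eval fun i => x i).comp (algebraMap ℝ (MvPolynomial (Fin D) ℝ)) =
      RingHom.id ℝ := by
    ext t; simp
  rw [EuclideanSpace.norm_sq_eq, polyEval, radialPoly, Polynomial.aeval_def, Polynomial.hom_eval₂,
    this, Polynomial.eval₂_id]
  simp

lemma radialPoly_mem {D n : ℕ} {p : Polynomial ℝ} (hp : p.natDegree ≤ n) :
    radialPoly D p ∈ polySpace D (2 * n) := by
  rw [radialPoly, Polynomial.aeval_eq_sum_range]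
  refine Submodule.sum_mem _ fun j hj => Submodule.smul_mem _ _ ?_
  rw [MvPolynomial.mem_restrictTotalDegree]
  have h1 : (∑ i : Fin D, MvPolynomial.X (R := ℝ) i ^ 2).totalDegree ≤ 2 :=
    MvPolynomial.totalDegree_finsetSum_le fun i _ => (MvPolynomial.totalDegree_X_pow i 2).le
  have h2 := MvPolynomial.totalDegree_pow (∑ i : Fin D, MvPolynomial.X (R := ℝ) i ^ 2) j
  have := Finset.mem_range.1 hj
  nlinarith

/-- The hypothesis `hp` asks that `‖x‖ = 1` be effectively true on the boundary: it is used for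
balls and for the one-dimensional box. -/
lemma RadialPair.radialPoly {B C : MvPolynomial (Fin (d + 1)) ℝ →ₗ[ℝ] ℝ} (h : RadialPair B C)
    {p : Polynomial ℝ} (hp : ∀ r, B (dilate r (radialPoly (d + 1) p)) = p.eval (r ^ 2)) :
    B (radialPoly (d + 1) p) = p.eval 1 ∧
      C (radialPoly (d + 1) p) = (d + 1) / 2 * radialMoment d p := by
  have heq : radialProfile B (_root_.radialPoly (d + 1) p) = p := by
    refine Polynomial.eq_of_infinite_eval_eq _ _ ((Set.Ioi_infinite (0 : ℝ)).mono fun t ht => ?_)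
    rw [Set.mem_ofPred_eq, ← Real.sq_sqrt (le_of_lt ht), h.eval_radialProfile, hp]
  rw [← h.eval_one_radialProfile, ← h.radialMoment_radialProfile, heq]
  exact ⟨rfl, rfl⟩

lemma averageFunctional_eq_of_const {D : ℕ} {A : Set (EuclideanSpace ℝ (Fin D))} (hA : IsCompact A)
    {μ : Measure (EuclideanSpace ℝ (Fin D))} (hμ : μ A ≠ ⊤) (h0 : μ A ≠ 0)
    {U : MvPolynomial (Fin D) ℝ} {c : ℝ} (h : ∀ x ∈ A, polyEval U x = c) :
    averageFunctional hA hμ U = c := by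
  rw [averageFunctional_congr hA hμ (V := c • 1), map_smul, averageFunctional_one hA hμ h0,
    smul_eq_mul, mul_one]
  intro x hx
  rw [h x hx]
  simp [polyEval]

/-- An extremal polynomial for the ball, or for the box in dimension one. -/
lemma exists_extremal (d n : ℕ) : ∃ U ∈ polySpace (d + 1) (2 * n),
    (∀ x : EuclideanSpace ℝ (Fin (d + 1)), ‖x‖ ≤ 1 → 0 ≤ polyEval U x) ∧
    (0 < ballCellFunctional d U ∧
      ballBoundaryFunctional d U = ballWeight d n * ballCellFunctional d U) ∧
    (d = 0 → 0 < boxCellFunctional d U ∧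
      boxBoundaryFunctional d U = ballWeight d n * boxCellFunctional d U) := by
  obtain ⟨-, -, -, -, p, hdeg, hpos, hp0, hp⟩ := Radau.exists_endpoint_bound d n
  have hmom := Radau.moment_pos d hp0 hpos
  have hC : 0 < ((d : ℝ) + 1) / 2 * radialMoment d p := by positivity
  rw [ballWeight_mul] at hp
  refine ⟨radialPoly (d + 1) p, radialPoly_mem hdeg, fun x hx => ?_, ?_, ?_⟩
  · rw [polyEval_radialPoly]
    exact hpos _ ⟨by positivity, pow_le_one₀ (norm_nonneg x) hx⟩
  · obtain ⟨h1, h2⟩ := (radialPair_ball d).radialPoly (p := p) fun r =>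
      averageFunctional_eq_of_const _ _ (hausdorffMeasure_sphere_ne_zero d) fun x hx => by
        rw [mem_sphere_zero_iff_norm] at hx
        rw [polyEval_dilate, polyEval_radialPoly, norm_smul, hx, mul_one, Real.norm_eq_abs, sq_abs]
    rw [h1, h2]
    exact ⟨hC, hp⟩
  · rintro rfl
    obtain ⟨h1, h2⟩ := (radialPair_box 0).radialPoly (p := p) fun r =>
      averageFunctional_eq_of_const (isCompact_frontier (isCompact_boxCell 1))
        (hausdorffMeasure_frontier_boxCell_ne_top 0) (hausdorffMeasure_frontier_boxCell_ne_zero 0) fun x hx => by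
        rw [AlgHom.toLinearMap_apply, polyEval_center, polyEval_dilate, polyEval_radialPoly,
          EuclideanSpace.norm_sq_eq, Fin.sum_univ_succ, Fin.sum_univ_zero]
        obtain ⟨-, i, hi⟩ := mem_frontier_boxCell.1 hx
        rw [Subsingleton.elim (α := Fin 1) i 0] at hi
        rcases hi with hi | hi <;> norm_num [hi]
    rw [h1, h2]
    exact ⟨hC, hp⟩

theorem optimalWeight_ballCell {n k : ℕ} (hk : 2 * n ≤ k) (hk' : k ≤ 2 * n + 1) :
    optimalWeight (ballCell (d + 1)) (polySpace (d + 1) k) = (ballWeight d n : EReal) := by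
  refine le_antisymm (optimalWeight_ballCell_le hk') ?_
  obtain ⟨U, hU, hpos, ⟨hC, hM⟩, -⟩ := exists_extremal d n
  refine le_iSup₂_of_le U ⟨polySpace_mono hk hU, fun x hx => hpos x (mem_closedBall_zero_iff.1 hx),
    hC⟩ (EReal.coe_le_coe (le_of_eq ?_))
  rw [boundaryCrowding, boundaryAverage_ballCell, cellAverage_ballCell, hM,
    mul_div_cancel_right₀ _ hC.ne']

theorem optimalWeight_boxCell_one {n k : ℕ} (hk : 2 * n ≤ k) (hk' : k ≤ 2 * n + 1) :
    optimalWeight (boxCell 1) (polySpace 1 k) = (ballWeight 0 n : EReal) := by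
  refine le_antisymm (optimalWeight_boxCell_le (d := 0) hk') ?_
  obtain ⟨U, hU, hpos, -, h⟩ := exists_extremal 0 n
  obtain ⟨hC, hM⟩ := h rfl
  refine le_optimalWeight_boxCell (d := 0) (polySpace_mono hk hU) (fun x hx => hpos x ?_) hC hM
  rw [EuclideanSpace.norm_eq]
  have := hx 0
  rw [Set.mem_Icc, ← abs_le] at this
  simpa using this

/-- The monomial `x₀ ^ (2 n)` has ratio `(2 n + D) / D` by `scale`. This equals the ball weight for
`n ≤ 1`, where `⌊n / 2⌋ = 0` and `⌊(n + 1) / 2⌋ = n`. -/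
theorem optimalWeight_boxCell_of_lt_four {n k : ℕ} (hn : n ≤ 1) (hk : 2 * n ≤ k)
    (hk' : k ≤ 2 * n + 1) :
    optimalWeight (boxCell (d + 1)) (polySpace (d + 1) k) = (ballWeight d n : EReal) := by
  refine le_antisymm (optimalWeight_boxCell_le hk') ?_
  set α : Fin (d + 1) →₀ ℕ := Finsupp.single 0 (2 * n) with hα
  have hdeg : α.degree = 2 * n := Finsupp.degree_single _ _
  have hC : 0 < boxCellFunctional d (MvPolynomial.monomial α 1) := by
    rw [boxCellFunctional_monomial]
    refine Finset.prod_pos fun i _ => ?_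
    have he : Even (α i) := by
      rw [hα, Finsupp.single_apply]; split_ifs <;> simp
    have := two_mul_integral_centered_pow (α i)
    rw [he.neg_one_pow] at this
    refine pos_of_mul_pos_right (a := 2 * ((α i : ℝ) + 1)) ?_ (by positivity)
    rw [this]; norm_num
  refine le_optimalWeight_boxCell (V := MvPolynomial.monomial α 1) ?_ (fun x _ => ?_) hC ?_
  · rw [MvPolynomial.mem_restrictTotalDegree]
    refine (MvPolynomial.totalDegree_monomial_le _ _).trans (le_trans (le_of_eq ?_) hk)
    exact hdeg
  · rw [polyEval_monomial]
    refine Finset.prod_nonneg fun i _ => Even.pow_nonneg ?_ _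
    rw [hα, Finsupp.single_apply]; split_ifs <;> simp
  · have h := (radialPair_box d).scale α
    have hw : ballWeight d n * (d + 1) = 2 * n + (d + 1) := by
      rw [ballWeight]
      push_cast
      rcases Nat.le_one_iff_eq_zero_or_eq_one.1 hn with rfl | rfl
      · field_simp
        simp
      · field_simp
        norm_num
    have hd : (d : ℝ) + 1 ≠ 0 := by positivity
    rw [hdeg] at h
    push_cast at h
    refine mul_left_cancel₀ hd ?_
    rw [← h, ← hw]
    ring

end

/-! ### Attainment of the supremum -/

section Attained

/-- A ratio of linear functionals on a finite-dimensional cone cut out by pointwise inequalities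
attains its supremum. -/
lemma exists_max_ratio {V ι : Type*} [AddCommGroup V] [Module ℝ V] [FiniteDimensional ℝ V]
    (e : ι → V →ₗ[ℝ] ℝ) (B C : V →ₗ[ℝ] ℝ)
    (hC : ∀ v : V, v ≠ 0 → (∀ i, 0 ≤ e i v) → 0 < C v)
    {v₀ : V} (hv₀ : v₀ ≠ 0) (hv₀' : ∀ i, 0 ≤ e i v₀) :
    ∃ v, v ≠ 0 ∧ (∀ i, 0 ≤ e i v) ∧ ∀ w, w ≠ 0 → (∀ i, 0 ≤ e i w) → B w / C w ≤ B v / C v := by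
  let φ : V ≃ₗ[ℝ] (Fin (Module.finrank ℝ V) → ℝ) := (Module.finBasis ℝ V).equivFun
  -- The ratio is invariant under positive scaling, so it suffices to maximise it over the compact
  -- slice of the cone by the unit sphere; `hC` makes it continuous there.
  let T : Set (Fin (Module.finrank ℝ V) → ℝ) :=
    Metric.sphere 0 1 ∩ {x | ∀ i, 0 ≤ e i (φ.symm x)}
  have hcont : ∀ f : V →ₗ[ℝ] ℝ, Continuous fun x => f (φ.symm x) := fun f =>
    (f ∘ₗ φ.symm.toLinearMap).continuous_of_finiteDimensional
  have hT : IsCompact T := by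
    refine (isCompact_sphere 0 1).inter_right ?_
    simp only [Set.ofPred_forall]
    exact isClosed_iInter fun i => isClosed_le continuous_const (hcont (e i))
  have hne : ∀ x ∈ T, φ.symm x ≠ 0 := by
    rintro x ⟨hx, -⟩ h0
    rw [LinearEquiv.map_eq_zero_iff] at h0
    rw [h0, mem_sphere_zero_iff_norm, norm_zero] at hx
    exact zero_ne_one hx
  have hscale : ∀ w : V, w ≠ 0 → (∀ i, 0 ≤ e i w) → ∃ c : ℝ, 0 < c ∧ φ (c • w) ∈ T := by
    intro w hw hpos
    have hn : 0 < ‖φ w‖ := norm_pos_iff.2 (by simpa using hw)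
    refine ⟨‖φ w‖⁻¹, inv_pos.2 hn, ?_, fun i => ?_⟩
    · rw [mem_sphere_zero_iff_norm, map_smul, norm_smul, norm_inv, norm_norm, inv_mul_cancel₀ hn.ne']
    · rw [φ.symm_apply_apply, map_smul, smul_eq_mul]
      exact mul_nonneg (inv_nonneg.2 hn.le) (hpos i)
  obtain ⟨c₀, -, hc₀⟩ := hscale v₀ hv₀ hv₀'
  obtain ⟨x, hx, hmax⟩ := hT.exists_isMaxOn ⟨_, hc₀⟩
    (f := fun x => B (φ.symm x) / C (φ.symm x))
    ((hcont B).continuousOn.div (hcont C).continuousOn fun x hx => (hC _ (hne x hx) hx.2).ne')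
  refine ⟨φ.symm x, hne x hx, hx.2, fun w hw hpos => ?_⟩
  obtain ⟨c, hc, hcT⟩ := hscale w hw hpos
  have := hmax hcT
  simp only [Set.mem_ofPred_eq, φ.symm_apply_apply, map_smul, smul_eq_mul] at this
  rwa [mul_div_mul_left _ _ hc.ne'] at this

end Attained

/-! ### Roots of nonnegative polynomials -/

section DoubleRoots
open Polynomial

/-- An interior zero of a nonnegative function is a local minimum, so the derivative vanishes too.
-/
lemma X_sub_C_sq_dvd_of_nonneg {ℓ : ℝ[X]} (hpos : ∀ t ∈ Set.Icc (-1 : ℝ) 1, 0 ≤ ℓ.eval t) {t : ℝ}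
    (ht : t ∈ Set.Ioo (-1 : ℝ) 1) (h0 : ℓ.eval t = 0) : (X - C t) ^ 2 ∣ ℓ := by
  rcases eq_or_ne ℓ 0 with rfl | hℓ
  · exact dvd_zero _
  have hmin : IsLocalMin (fun s => ℓ.eval s) t := by
    filter_upwards [Icc_mem_nhds ht.1 ht.2] with s hs
    rw [h0]
    exact hpos s hs
  have hder := hmin.deriv_eq_zero
  rw [Polynomial.deriv] at hder
  rw [← le_rootMultiplicity_iff hℓ]
  exact (one_lt_rootMultiplicity_iff_isRoot hℓ).2 ⟨h0, hder⟩

lemma eq_zero_of_nonneg_of_roots {ℓ : ℝ[X]} (hpos : ∀ t ∈ Set.Icc (-1 : ℝ) 1, 0 ≤ ℓ.eval t)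
    {F : Finset ℝ} (hF : ∀ t ∈ F, t ∈ Set.Ioo (-1 : ℝ) 1 ∧ ℓ.eval t = 0)
    (hdeg : ℓ.natDegree < 2 * F.card) : ℓ = 0 := by
  by_contra hℓ
  have hdvd : ∏ t ∈ F, (X - C t) ^ 2 ∣ ℓ := by
    refine Finset.prod_dvd_of_coprime ?_ ?_
    · exact fun a _ b _ hab =>
        IsCoprime.pow (pairwise_coprime_X_sub_C Function.injective_id hab)
    · exact fun t ht => X_sub_C_sq_dvd_of_nonneg hpos (hF t ht).1 (hF t ht).2
  have := natDegree_le_of_dvd hdvd hℓ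
  rw [Finset.prod_pow, natDegree_pow, Radau.natDegree_prod_X_sub_C] at this
  omega

end DoubleRoots

/-! ### Positivity and vanishing on the box -/

section
variable {d : ℕ}

lemma interior_subset_boxCell {D : ℕ} {x : EuclideanSpace ℝ (Fin D)}
    (hx : ∀ i, x i ∈ Set.Ioo (0 : ℝ) 1) : x ∈ boxCell D := fun i => Set.Ioo_subset_Icc_self (hx i)

lemma isOpen_openBox (D : ℕ) :
    IsOpen {x : EuclideanSpace ℝ (Fin D) | ∀ i, x i ∈ Set.Ioo (0 : ℝ) 1} := by
  simp only [Set.ofPred_forall]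
  exact isOpen_iInter_of_finite fun i => isOpen_Ioo.preimage (by fun_prop)

/-- A continuous nonnegative function with zero integral over the box vanishes inside it. -/
lemma eq_zero_of_setIntegral_boxCell {D : ℕ} {f : EuclideanSpace ℝ (Fin D) → ℝ} (hf : Continuous f)
    (hpos : ∀ x ∈ boxCell D, 0 ≤ f x) (h0 : ∫ x in boxCell D, f x = 0)
    {x : EuclideanSpace ℝ (Fin D)} (hx : ∀ i, x i ∈ Set.Ioo (0 : ℝ) 1) : f x = 0 := by
  have h1 : f =ᵐ[volume.restrict (boxCell D)] 0 :=
    (setIntegral_eq_zero_iff_of_nonneg_ae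
      ((ae_restrict_iff' (isClosed_boxCell D).measurableSet).2 (ae_of_all _ hpos))
      (hf.continuousOn.integrableOn_compact (isCompact_boxCell D))).1 h0
  have h2 : f =ᵐ[volume.restrict {x : EuclideanSpace ℝ (Fin D) | ∀ i, x i ∈ Set.Ioo (0 : ℝ) 1}] 0 :=
    ae_restrict_of_ae_restrict_of_subset (fun _ => interior_subset_boxCell) h1
  exact Measure.eqOn_open_of_ae_eq h2 (isOpen_openBox D) hf.continuousOn continuousOn_const hx

lemma boxCellFunctional_pos {V : MvPolynomial (Fin (d + 1)) ℝ} (hV : V ≠ 0)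
    (hpos : ∀ x ∈ centeredBox (d + 1), 0 ≤ polyEval V x) : 0 < boxCellFunctional d V := by
  have hpos' := polyEval_nonneg_iff_centeredBox.2 hpos
  have hnn : 0 ≤ boxCellFunctional d V := averageFunctional_nonneg
    (isCompact_boxCell (d + 1)) (isCompact_boxCell (d + 1)).measure_ne_top hpos'
  refine lt_of_le_of_ne hnn fun h0 => hV ?_
  have h1 : ∫ x in boxCell (d + 1), polyEval (center (d + 1) V) x = 0 := by
    have : boxCellFunctional d V = ⨍ x in boxCell (d + 1), polyEval (center (d + 1) V) x := rfl
    rwa [this, setAverage_eq, measureReal_def, volume_boxCell, ENNReal.toReal_one, inv_one,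
      one_smul, eq_comm] at h0
  refine MvPolynomial.funext_set (fun _ => Set.Ioo (-1 : ℝ) 1)
    (fun _ => Set.Ioo_infinite (by norm_num)) fun z hz => ?_
  have h2 := eq_zero_of_setIntegral_boxCell (continuous_polyEval _) hpos' h1
    (x := WithLp.toLp 2 fun i => (z i + 1) / 2) fun i => by
      have := hz i (Set.mem_univ i)
      simp only [Set.mem_Ioo] at this ⊢
      constructor <;> linarith
  rw [polyEval_center, polyEval] at h2
  rw [map_zero, ← h2]
  congr 2
  ext i
  simp only
  ring

/-- If the average of a polynomial over the boundary of a concentric cube vanishes, so does the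
polynomial on the open faces of that cube. -/
lemma polyEval_eq_zero_of_boxBoundaryFunctional_dilate {V : MvPolynomial (Fin (d + 1)) ℝ}
    (hpos : ∀ x ∈ centeredBox (d + 1), 0 ≤ polyEval V x) {r : ℝ} (hr : r ∈ Set.Ioo (0 : ℝ) 1)
    (h0 : boxBoundaryFunctional d (dilate r V) = 0) {i : Fin (d + 1)} {z : Fin (d + 1) → ℝ}
    (hi : |z i| = r) (hz : ∀ j, j ≠ i → |z j| < r) : MvPolynomial.eval z V = 0 := by
  have hnn := polyEval_center_dilate_nonneg hpos ⟨hr.1.le, hr.2.le⟩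
  have h1 : boxBoundaryFunctional d (dilate r V) = ⨍ x in frontier (boxCell (d + 1)),
    polyEval (center (d + 1) (dilate r V)) x ∂μH[(d : ℝ)] := rfl
  rw [h1, setAverage_frontier_boxCell, mul_eq_zero] at h0
  have h2 := h0.resolve_left (by positivity)
  have hface : ∀ (p : Fin (d + 1) × Fin 2), ∀ y ∈ boxCell d,
      0 ≤ polyEval (center (d + 1) (dilate r V)) (faceMap p.1 (p.2 : ℕ) y) := fun p y hy =>
    hnn _ (faceMap_mem_boxCell (by obtain ⟨-, s⟩ := p; fin_cases s <;> simp) hy)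
  have h3 := (Finset.sum_eq_zero_iff_of_nonneg fun p _ =>
    setIntegral_nonneg (isClosed_boxCell d).measurableSet (hface p)).1 h2
  -- The indices `s = 0, 1` stand for the faces `z i = -r` and `z i = r`; a nonnegative integrand
  -- with zero average vanishes inside each.
  have key : ∀ s : Fin 2, z i = r * (2 * ((s : ℕ) : ℝ) - 1) → MvPolynomial.eval z V = 0 := by
    intro s hs
    have h4 := eq_zero_of_setIntegral_boxCell
      ((continuous_polyEval _).comp (isometry_faceMap i ((s : ℕ) : ℝ)).continuous) (hface (i, s))
      (h3 (i, s) (Finset.mem_univ _))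
      (x := WithLp.toLp 2 fun j => (z (i.succAbove j) / r + 1) / 2) fun j => by
        have h5 := hz _ (i.succAbove_ne j)
        have h6 : |z (i.succAbove j) / r| < 1 := by
          rw [abs_div, abs_of_pos hr.1, div_lt_one hr.1]; exact h5
        rw [abs_lt] at h6
        simp only [Set.mem_Ioo]
        constructor <;> linarith
    rw [Function.comp_apply, polyEval_center, polyEval_dilate, polyEval] at h4
    rw [← h4]
    congr 2
    ext j
    rcases Fin.eq_self_or_eq_succAbove i j with rfl | ⟨j, rfl⟩
    · simp [hs]
    · have := hr.1.ne'
      simp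
      field_simp
      ring
  rcases abs_choice (z i) with h | h
  · exact key 1 (by rw [← hi, h]; norm_num)
  · exact key 0 (by rw [← hi, h]; norm_num)

end

/-! ### Strict inequality for the box in dimension at least two and degree at least four -/

section
variable {d : ℕ}

lemma eval_aeval_polynomial {D : ℕ} (f : Fin D → Polynomial ℝ) (t : ℝ)
    (V : MvPolynomial (Fin D) ℝ) : (MvPolynomial.aeval f V).eval t =
      MvPolynomial.eval (fun i => (f i).eval t) V := by
  induction V using MvPolynomial.induction_on with
  | C a => simp
  | add p q hp hq => simp [hp, hq]
  | mul_X p i hp => simp [hp]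

lemma natDegree_aeval_le {D : ℕ} {f : Fin D → Polynomial ℝ} (hf : ∀ i, (f i).natDegree ≤ 1)
    (V : MvPolynomial (Fin D) ℝ) : (MvPolynomial.aeval f V).natDegree ≤ V.totalDegree := by
  conv_lhs => rw [MvPolynomial.as_sum V, _root_.map_sum]
  refine Polynomial.natDegree_sum_le_of_forall_le _ _ fun α hα => ?_
  rw [MvPolynomial.aeval_monomial]
  refine (Polynomial.natDegree_C_mul_le _ _).trans ((Polynomial.natDegree_prod_le _ _).trans
    (le_trans ?_ (MvPolynomial.le_totalDegree hα)))
  exact Finset.sum_le_sum fun i _ => Polynomial.natDegree_pow_le.trans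
    ((Nat.mul_le_mul_left _ (hf i)).trans (mul_one _).le)

/-- A polynomial that is nonnegative on the cube `[-1, 1] ^ D`, `D ≥ 2`, and vanishes on the
boundaries of sufficiently many concentric cubes is zero. -/
theorem eq_zero_of_vanish_on_cubes {D k : ℕ} {V : MvPolynomial (Fin D) ℝ} (hV : V ∈ polySpace D k)
    (hpos : ∀ x ∈ centeredBox D, 0 ≤ polyEval V x) {i₀ i₁ : Fin D} (hne : i₀ ≠ i₁) {S : Finset ℝ}
    (hS : ∀ r ∈ S, r ∈ Set.Ioo (0 : ℝ) 1) (hS0 : S.Nonempty) (hk : k < 4 * S.card + 4)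
    (hvan : ∀ r ∈ S, ∀ (i : Fin D) (z : Fin D → ℝ), |z i| = r → (∀ j, j ≠ i → |z j| < r) →
      MvPolynomial.eval z V = 0) : V = 0 := by
  classical
  rw [MvPolynomial.mem_restrictTotalDegree] at hV
  obtain ⟨r, hrS, hrmin⟩ := S.exists_min_image id hS0
  obtain ⟨ρ, hρS, hρmax⟩ := S.exists_max_image id hS0
  simp only [id] at hrmin hρmax
  have hr := hS r hrS
  have hρ := hS ρ hρS
  have hrρ : r ≤ ρ := hrmin ρ hρS
  -- Restrict `V` to the line through `z` along which coordinate `i₁` is `a` times coordinate `i₀`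
  -- and the others are fixed. The conditions say `r < a` and `a ρ < r`, for `r` and `ρ` the
  -- smallest and largest elements of `S`.
  have hline : ∀ z : Fin D → ℝ, 0 < z i₀ → r < z i₁ / z i₀ → z i₁ / z i₀ * ρ < r →
      (∀ j, j ≠ i₀ → j ≠ i₁ → |z j| < r) → MvPolynomial.eval z V = 0 := by
    intro z hz0 har haρ hz
    set a := z i₁ / z i₀ with ha
    have ha0 : 0 < a := hr.1.trans har
    have ha1 : a < 1 := by
      have : a * ρ < 1 * ρ := by linarith
      exact lt_of_mul_lt_mul_right this hρ.1.le
    let f : Fin D → Polynomial ℝ := fun i => if i = i₀ then Polynomial.X else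
      if i = i₁ then Polynomial.C a * Polynomial.X else Polynomial.C (z i)
    let ζ : ℝ → Fin D → ℝ := fun t i => if i = i₀ then t else if i = i₁ then a * t else z i
    have hf : ∀ t i, (f i).eval t = ζ t i := fun t i => by
      simp only [f, ζ]
      split_ifs <;> simp
    have hfdeg : ∀ i, (f i).natDegree ≤ 1 := fun i => by
      simp only [f]
      split_ifs
      · exact Polynomial.natDegree_X_le
      · exact (Polynomial.natDegree_C_mul_le _ _).trans Polynomial.natDegree_X_le
      · simp
    have heval : ∀ t, (MvPolynomial.aeval f V).eval t = MvPolynomial.eval (ζ t) V := fun t => by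
      rw [eval_aeval_polynomial]; simp only [hf]
    have hq0 : 0 < r / a := div_pos hr.1 ha0
    have hq1 : r / a < 1 := (div_lt_one ha0).2 har
    have hqρ : ρ < r / a := by rw [lt_div_iff₀ ha0]; linarith
    -- An additional pair of roots beyond the largest cube: here coordinate `i₁` is `±r`. `V`
    -- vanishes on the open face of the cube of size `r` in that hyperplane, hence along the whole
    -- line parallel to the `i₀` axis. Without this pair the root count would be too small.
    have hext : ∀ t : ℝ, |t| = r / a → MvPolynomial.eval (ζ t) V = 0 := by
      intro t ht
      let g : Fin D → Polynomial ℝ := fun i => if i = i₀ then Polynomial.X else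
        Polynomial.C (ζ t i)
      have hg : ∀ s, (MvPolynomial.aeval g V).eval s =
          MvPolynomial.eval (fun i => if i = i₀ then s else ζ t i) V := fun s => by
        rw [eval_aeval_polynomial]
        congr 2
        funext i
        simp only [g]
        split_ifs <;> simp
      have hg0 : MvPolynomial.aeval g V = 0 := by
        refine Polynomial.eq_zero_of_infinite_isRoot _
          ((Set.Ioo_infinite (show -r < r by linarith [hr.1])).mono fun s hs => ?_)
        rw [Set.mem_ofPred_eq, Polynomial.IsRoot, hg]
        refine hvan r hrS i₁ _ ?_ fun j hj => ?_
        · simp only [ζ, hne.symm, if_false, if_true]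
          rw [abs_mul, abs_of_pos ha0, ht, mul_div_cancel₀ _ ha0.ne']
        · by_cases hj0 : j = i₀
          · simp only [hj0, if_true]; exact abs_lt.2 hs
          · simp only [hj0, hj, ζ, if_false]; exact hz j hj0 hj
      have := hg t
      rw [hg0, Polynomial.eval_zero] at this
      rw [this]
      congr 2
      funext i
      simp only [ζ]
      split_ifs <;> rfl
    -- For `|t| ∈ S`, coordinate `i₀` strictly dominates the others, so the point lies on an open
    -- face of the cube of size `|t|`.
    have hroot : ∀ t : ℝ, |t| ∈ S → MvPolynomial.eval (ζ t) V = 0 := by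
      intro t ht
      have ht0 := (hS _ ht).1
      refine hvan _ ht i₀ _ (by simp [ζ]) fun j hj => ?_
      by_cases hj1 : j = i₁
      · simp only [ζ, hj1, hne.symm, if_false, if_true]
        rw [abs_mul, abs_of_pos ha0]
        nlinarith
      · simp only [ζ, hj, hj1, if_false]
        exact (hz j hj hj1).trans_le (hrmin _ ht)
    have hzero : MvPolynomial.aeval f V = 0 := by
      let S' := insert (r / a) S
      have hS' : ∀ t ∈ S', t ∈ Set.Ioo (0 : ℝ) 1 := by
        intro t ht
        rcases Finset.mem_insert.1 ht with rfl | ht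
        · exact ⟨hq0, hq1⟩
        · exact hS t ht
      have hnot : r / a ∉ S := fun h => absurd (hρmax _ h) (not_le.2 hqρ)
      -- These `2 (S.card + 1)` roots lie in `(-1, 1)` and count double, exceeding `k < 4 * S.card +
      -- 4`.
      have hcard : (S' ∪ S'.image fun t => -t).card = 2 * (S.card + 1) := by
        rw [Finset.card_union_of_disjoint, Finset.card_image_of_injective _ neg_injective,
          Finset.card_insert_of_notMem hnot, two_mul]
        refine Finset.disjoint_left.2 fun t ht ht' => ?_
        obtain ⟨s, hs, rfl⟩ := Finset.mem_image.1 ht'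
        linarith [(hS' _ ht).1, (hS' _ hs).1]
      have hval : ∀ t : ℝ, |t| ∈ S' → MvPolynomial.eval (ζ t) V = 0 := by
        intro t ht
        rcases Finset.mem_insert.1 ht with ht | ht
        · exact hext t ht
        · exact hroot t ht
      refine eq_zero_of_nonneg_of_roots (F := S' ∪ S'.image fun t => -t) (fun t ht => ?_)
        (fun t ht => ?_) ?_
      · rw [heval]
        refine hpos (WithLp.toLp 2 (ζ t)) fun i => ?_
        rw [Set.mem_Icc, ← abs_le] at ht ⊢
        simp only [ζ]
        split_ifs with h0 h1
        · exact ht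
        · rw [abs_mul, abs_of_pos ha0]
          exact mul_le_one₀ ha1.le (abs_nonneg _) ht
        · exact ((hz i h0 h1).trans hr.2).le
      · rw [heval]
        have habs : |t| ∈ S' ∧ |t| < 1 := by
          rcases Finset.mem_union.1 ht with ht | ht
          · rw [abs_of_pos (hS' t ht).1]; exact ⟨ht, (hS' t ht).2⟩
          · obtain ⟨s, hs, rfl⟩ := Finset.mem_image.1 ht
            rw [abs_neg, abs_of_pos (hS' s hs).1]
            exact ⟨hs, (hS' s hs).2⟩
        exact ⟨abs_lt.1 habs.2, hval t habs.1⟩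
      · have := natDegree_aeval_le hfdeg V
        rw [hcard]
        omega
    have := heval (z i₀)
    rw [hzero, Polynomial.eval_zero] at this
    rw [this]
    congr 2
    funext i
    simp only [ζ]
    split_ifs with h0 h1
    · rw [h0]
    · rw [h1, ha, div_mul_cancel₀ _ hz0.ne']
    · rfl
  -- Any `q` between `ρ` and 1 would do: with `z i₀ ∈ (q, 1)` and `z i₁ ∈ (r, q r / ρ)` the slope
  -- satisfies both conditions of `hline`, so `V` vanishes on a product of infinite sets.
  set q := (1 + ρ) / 2 with hq
  have hq1 : q < 1 := by linarith [hρ.2]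
  have hqρ : ρ < q := by linarith [hρ.2]
  have hq0 : 0 < q := hρ.1.trans hqρ
  have hrq : r < q * (r / ρ) := by
    rw [mul_div_assoc', lt_div_iff₀ hρ.1]
    nlinarith [hr.1]
  refine MvPolynomial.funext_set (fun i => if i = i₀ then Set.Ioo q 1 else
    if i = i₁ then Set.Ioo r (q * (r / ρ)) else Set.Ioo (-r) r) (fun i => ?_) fun z hz => ?_
  · split_ifs
    · exact Set.Ioo_infinite hq1
    · exact Set.Ioo_infinite hrq
    · exact Set.Ioo_infinite (by linarith [hr.1])
  · have hz0 := hz i₀ (Set.mem_univ _)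
    have hz1 := hz i₁ (Set.mem_univ _)
    simp only [if_true, hne.symm, if_false, Set.mem_Ioo] at hz0 hz1
    have hp : 0 < z i₀ := hq0.trans hz0.1
    rw [map_zero]
    refine hline z hp ?_ ?_ fun j h0 h1 => ?_
    · rw [lt_div_iff₀ hp]
      nlinarith [hr.1]
    · rw [div_mul_eq_mul_div, div_lt_iff₀ hp]
      have h2 : q * (r / ρ) * ρ = q * r := by field_simp [hρ.1.ne']
      nlinarith [hr.1, hρ.1]
    · have := hz j (Set.mem_univ _)
      simp only [h0, h1, if_false] at this
      exact abs_lt.2 this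

/-- For degree at least four in dimension at least two, the box has a strictly smaller optimal
interior weight than the ball. -/
theorem optimalWeight_boxCell_lt {n k : ℕ} (hd : 1 ≤ d) (hn : 2 ≤ n) (hk : k ≤ 2 * n + 1) :
    optimalWeight (boxCell (d + 1)) (polySpace (d + 1) k) < (ballWeight d n : EReal) := by
  obtain ⟨S, hS, hcard, hle⟩ := (radialPair_box d).exists_le n
  have hC : ∀ V : polySpace (d + 1) k, V ≠ 0 →
      (∀ x : centeredBox (d + 1), 0 ≤ polyEval (V : MvPolynomial (Fin (d + 1)) ℝ) x) →
      0 < boxCellFunctional d V := fun V hV hpos =>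
    boxCellFunctional_pos (by simpa using hV) fun x hx => hpos ⟨x, hx⟩
  have h1 : (1 : MvPolynomial (Fin (d + 1)) ℝ) ∈ polySpace (d + 1) k := by
    rw [MvPolynomial.mem_restrictTotalDegree, MvPolynomial.totalDegree_one]
    exact Nat.zero_le _
  let ev : centeredBox (d + 1) → polySpace (d + 1) k →ₗ[ℝ] ℝ := fun x =>
    { toFun := fun V => polyEval (V : MvPolynomial (Fin (d + 1)) ℝ) x
      map_add' := fun V W => by simp [polyEval]
      map_smul' := fun c V => by simp [polyEval] }
  obtain ⟨V, hV0, hVpos, hmax⟩ := exists_max_ratio ev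
    (boxBoundaryFunctional d ∘ₗ (polySpace (d + 1) k).subtype)
    (boxCellFunctional d ∘ₗ (polySpace (d + 1) k).subtype) hC
    (v₀ := ⟨1, h1⟩) (fun h => one_ne_zero (congrArg Subtype.val h))
    (fun x => by simp [ev, polyEval])
  have hVC := hC V hV0 hVpos
  have hVpos' : ∀ x ∈ centeredBox (d + 1), 0 ≤ polyEval (V : MvPolynomial (Fin (d + 1)) ℝ) x :=
    fun x hx => hVpos ⟨x, hx⟩
  obtain ⟨hle1, heq1⟩ := hle V (polySpace_mono hk V.2) fun r hr =>
    boxBoundaryFunctional_dilate_nonneg hVpos' hr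
  have hlt : boxBoundaryFunctional d V < ballWeight d n * boxCellFunctional d V := by
    refine lt_of_le_of_ne hle1 fun heq => hV0 ?_
    have hz := heq1 heq
    -- Two coordinates exist since `d ≥ 1`, a node exists since `n ≥ 2`, and the degree condition is
    -- `k ≤ 2 n + 1 < 4 ⌊n / 2⌋ + 4`.
    refine Subtype.ext (eq_zero_of_vanish_on_cubes V.2 hVpos' (i₀ := 0) (i₁ := ⟨1, by omega⟩) ?_ hS
      (Finset.card_pos.1 (by omega)) (by omega) fun r hr i z hi hzj => ?_)
    · exact fun h => by simpa using congrArg Fin.val h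
    · exact polyEval_eq_zero_of_boxBoundaryFunctional_dilate hVpos' (hS r hr) (hz r hr) hi hzj
  refine lt_of_le_of_lt (optimalWeight_boxCell_le_of_forall
    (M := boxBoundaryFunctional d V / boxCellFunctional d V) fun W hW hWpos hWC => ?_) ?_
  · have := hmax ⟨W, hW⟩ (fun h => ?_) fun x => hWpos x x.2
    · exact (div_le_iff₀ hWC).1 this
    · have : W = 0 := congrArg Subtype.val h
      rw [this, map_zero] at hWC
      exact hWC.false
  · exact EReal.coe_lt_coe_iff.2 ((div_lt_iff₀ hVC).2 hlt)

end

end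

theorem mainTheorem11 (D : ℕ) (hD : 1 ≤ D) :
    (∀ n : ℕ,
      optimalWeight (ballCell D) (polySpace D (2 * n)) =
          (((((n / 2 : ℕ) : ℝ) + 1) * (2 * (((n + 1) / 2 : ℕ) : ℝ) + (D : ℝ)) / (D : ℝ) : ℝ) : EReal) ∧
      optimalWeight (ballCell D) (polySpace D (2 * n + 1)) =
          (((((n / 2 : ℕ) : ℝ) + 1) * (2 * (((n + 1) / 2 : ℕ) : ℝ) + (D : ℝ)) / (D : ℝ) : ℝ) : EReal)) ∧
    (∀ k : ℕ,
      optimalWeight (boxCell D) (polySpace D k) ≤ optimalWeight (ballCell D) (polySpace D k) ∧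
      (optimalWeight (boxCell D) (polySpace D k) = optimalWeight (ballCell D) (polySpace D k) ↔
        D = 1 ∨ k < 4)) := by
  obtain ⟨d, rfl⟩ := Nat.exists_eq_add_of_le' hD
  refine ⟨fun n => ⟨optimalWeight_ballCell le_rfl (by omega),
    optimalWeight_ballCell (by omega) le_rfl⟩, fun k => ?_⟩
  have h1 : 2 * (k / 2) ≤ k := by omega
  have h2 : k ≤ 2 * (k / 2) + 1 := by omega
  rw [optimalWeight_ballCell h1 h2]
  refine ⟨optimalWeight_boxCell_le h2, fun heq => ?_, ?_⟩
  · by_contra! h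
    exact (optimalWeight_boxCell_lt (by omega) (by omega) h2).ne heq
  · rintro (h | h)
    · obtain rfl : d = 0 := by omega
      exact optimalWeight_boxCell_one h1 h2
    · exact optimalWeight_boxCell_of_lt_four (by omega) h1 h2
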